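/- **System.** Let $p_1,\dots,p_k\le m\le n$ and consider $\dot x=f(x)+G(x)u$, $y_i=h_i(x)\in\mathbb R^{p_i}$ ($1\le i\le k$), $x\in\mathbb R^n$, $u\in\mathbb R^m$, with $f(0)=0$, $h_i(0)=0$, where smaller $i$ means higher priority. Assume that $G(0)$ has full rank $m$ and that for every $i$ the subsystem with output $y_i$ has a vector relative degree $(r_{i1},\dots,r_{ip_i})$ at $0$ (so $r_{ij}\ge1$), and that $f,G,h_i$ are $C^q$ for some $q\ge\max r_{ij}$. Let $D$ be an open neighbourhood of $0$ on which $G(x)$ has rank $m$ and $L_GL_f^{l}h_{ij}(x)=0$ for $0\le l\le r_{ij}-2$. Put $\kappa_{ij}=L_f^{r_{ij}}h_{ij}$, let $J_i$ be the matrix with rows $L_GL_f^{r_{ij}-1}h_{ij}$, $J=\mathrm{col}(J_1,\dots,J_k)$, $\kappa=\mathrm{col}(\kappa_1,\dots,\kappa_k)$, and $\xi_i=\mathrm{col}(h_{i1},\dots,L_f^{r_{i1}-1}h_{i1},\dots,h_{ip_i},\dots,L_f^{r_{ip_i}-1}h_{ip_i})$, $r_i=\sum_j r_{ij}$. With the Moore-Penrose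 inverse $^+$ let $N_{1:0}=I$, $N_{1:i}=I-J_{1:i}^+J_{1:i}$, $N=N_{1:k}$, $P_i=(J_iN_{1:i-1})^+(J_iN_{1:i-1})$, $\rho_i(x)=\mathrm{rank}\,P_i(x)$, and let, for every $x\in D$, $J=LQ$ be a factorization with $L=[L_{ij}]$ block lower triangular, $L_{ij}(x)\in\mathbb R^{p_i\times\rho_j(x)}$, $QQ^T=I$, $Q_j(x)\in\mathbb R^{\rho_j(x)\times m}$, $J_iP_j=L_{ij}Q_j$ and $P_j=Q_j^TQ_j$. Let $L_D=\mathrm{diag}(L_{11},\dots,L_{kk})$ and $\Omega_{1:i}=\{x\in D:\rho_1(x)+\dots+\rho_i(x)=p_1+\dots+p_i\}$. **Region.** Let $1\le i_0\le k$, and let $\Phi_0=(\eta_0,\xi_0)$, with $\xi_0=\mathrm{col}(\xi_1,\dots,\xi_{i_0})$ and $\Phi_0(0)=0$, be a ($C^1$) diffeomorphism of an open neighbourhood $D_0\subset\Omega_{1:i_0}$ of $0$ onto an open subset of $\mathbb R^n$. Let $C_0\subset\Phi_0(D_0)$ be a compact neighbourhood of $0$. Functions of $x\in D_0$ are regarded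 as functions of $z_0=\Phi_0(x)$. Put $f_0=L_f\eta_0$, $G_0=L_G\eta_0$. **Controller.** Let $\Gamma(x)=[\Gamma_{ij}(x)]$ be block lower triangular for $x\in D$, with $\mathrm{rank}(L_{ii}L_{ii}^T\Gamma_{ii})=\rho_i$ and $L_{ii}L_{ii}^T\Gamma_{ii}+(L_{ii}L_{ii}^T\Gamma_{ii})^T\ge0$ on $D$ for all $i$; for each $i\le i_0$ let there be $\varsigma_i>0$ with $\frac12\bigl(L_{ii}L_{ii}^T\Gamma_{ii}+(L_{ii}L_{ii}^T\Gamma_{ii})^T\bigr)\ge\varsigma_iI$ on $C_0$; let $\Gamma_{ij}$ be continuous on $D_0$ for $i,j\le i_0$; and let $\Gamma$ be bounded on every compact subset of $D_0$. Let $K_i\in\mathbb R^{p_i\times r_i}$ be arbitrary gains. Let the references $y_{ij}^\star:[0,\infty)\to\mathbb R$ be of class $C^{r_{ij}}$ with bounded derivatives of orders $0,\dots,r_{ij}$, let $\xi_i^\star$ collect their derivatives of orders $0,\dots,r_{ij}-1$ (in the same order as $\xi_i$) and $\kappa_i^\star$ those of order $r_{ij}$. Let $u_f(t,x)\in\mathbb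 R^m$ be Lebesgue measurable in $t\ge 0$ for every $x\in\Phi_0^{-1}(C_0)$ and take values in a fixed convex compact set for $(t,x)\in[0,\infty)\times\Phi_0^{-1}(C_0)$. Put $$v_i=-K_i(\xi_i-\xi_i^\star)+\kappa_i^\star,\qquad u^\pi=Q^TL_D^T\Gamma(v-\kappa)+Nu_f,\qquad E=[E_{ij}]=I-LL_D^T\Gamma .$$ **Closed loop.** A *Krasovskii solution* on $[0,T)$ is a function $z_0=(\eta_0,\xi_0)$, absolutely continuous on every compact subinterval of $[0,T)$, that satisfies for almost every $t\in[0,T)$ $$\dot\eta_0\in\mathcal K\bigl[f_0+G_0u^\pi\bigr](t,z_0),\qquad \dot\xi_i=A_i\xi_i+B_iv_i-B_i\sum_{j=1}^{i}E_{ij}(v_j-\kappa_j)\quad(1\le i\le i_0),$$ where $(A_i,B_i)$ is the canonical pair of $p_i$ chains of integrators of lengths $r_{i1},\dots,r_{ip_i}$, and $\mathcal K[g](t,z)=\bigcap_{\delta>0}\overline{\mathrm{co}}\,\bigl\{g(t,z'):\|z'-z\|\le\delta,\ z'\in\Phi_0(D_0)\bigr\}$. **Claim.** For every $z_0^\circ\in\mathrm{int}(C_0)$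 there are $T\in(0,\infty]$ and a Krasovskii solution $z_0:[0,T)\to\mathrm{int}(C_0)$ with $z_0(0)=z_0^\circ$ such that either $T=\infty$, or $T<\infty$ and $z_0$ extends to an absolutely continuous function on $[0,T]$ with $z_0(T)\in\mathrm{bd}(C_0)$. -/

import Mathlib

open Set Filter Topology MeasureTheory
open scoped Matrix

noncomputable section

namespace PriorityControl

/-! ### Moore-Penrose pseudoinverse of a real matrix -/

/-- `X` satisfies the four Penrose equations for `M`. -/
structure IsMoorePenrose {α β : Type*} [Fintype α] [Fintype β]
    (M : Matrix α β ℝ) (X : Matrix β α ℝ) : Prop where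
  mul_mul : M * X * M = M
  mul_mul' : X * M * X = X
  symm_left : (M * X)ᵀ = M * X
  symm_right : (X * M)ᵀ = X * M

theorem IsMoorePenrose.unique {α β : Type*} [Fintype α] [Fintype β]
    {M : Matrix α β ℝ} {X Y : Matrix β α ℝ}
    (hX : IsMoorePenrose M X) (hY : IsMoorePenrose M Y) : X = Y := by
  have h1 : M * X = M * Y := by
    calc M * X = (M * Y * M) * X := by rw [hY.mul_mul]
      _ = (M * Y) * (M * X) := by simp only [Matrix.mul_assoc]
      _ = (M * Y)ᵀ * (M * X)ᵀ := by rw [hY.symm_left, hX.symm_left]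
      _ = ((M * X * M) * Y)ᵀ := by
          rw [← Matrix.transpose_mul]; simp only [Matrix.mul_assoc]
      _ = M * Y := by rw [hX.mul_mul, hY.symm_left]
  have h2 : X * M = Y * M := by
    calc X * M = X * (M * Y * M) := by rw [hY.mul_mul]
      _ = (X * M) * (Y * M) := by simp only [Matrix.mul_assoc]
      _ = (X * M)ᵀ * (Y * M)ᵀ := by rw [hX.symm_right, hY.symm_right]
      _ = (Y * (M * X * M))ᵀ := by
          rw [← Matrix.transpose_mul]; simp only [Matrix.mul_assoc]
      _ = Y * M := by rw [hX.mul_mul, hY.symm_right]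
  calc X = X * (M * X) := by rw [← Matrix.mul_assoc, hX.mul_mul']
    _ = (X * M) * Y := by rw [h1, Matrix.mul_assoc]
    _ = Y := by rw [h2, hY.mul_mul']

theorem exists_isMoorePenrose {α β : Type*} [Fintype α] [Fintype β]
    (M : Matrix α β ℝ) : ∃ X, IsMoorePenrose M X := by
  classical
  have hH : (Mᵀ * M).IsHermitian := by
    simpa [Matrix.conjTranspose_eq_transpose_of_trivial] using
      Matrix.isHermitian_conjTranspose_mul_self M
  obtain ⟨U, D, hU, hD⟩ : ∃ (U : Matrix β β ℝ) (D : β → ℝ), Uᵀ * U = 1 ∧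
      Mᵀ * M = U * Matrix.diagonal D * Uᵀ := by
    refine ⟨hH.eigenvectorUnitary, hH.eigenvalues, ?_, ?_⟩
    · have := Unitary.coe_star_mul_self hH.eigenvectorUnitary
      rwa [Matrix.star_eq_conjTranspose, Matrix.conjTranspose_eq_transpose_of_trivial] at this
    · have := hH.spectral_theorem
      rw [Unitary.conjStarAlgAut_apply, Matrix.star_eq_conjTranspose,
        Matrix.conjTranspose_eq_transpose_of_trivial] at this
      exact this
  have key : ∀ a b : β → ℝ, (U * Matrix.diagonal a * Uᵀ) * (U * Matrix.diagonal b * Uᵀ)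
      = U * Matrix.diagonal (fun i => a i * b i) * Uᵀ := by
    intro a b
    calc _ = U * Matrix.diagonal a * (Uᵀ * U) * Matrix.diagonal b * Uᵀ := by
          simp only [Matrix.mul_assoc]
      _ = _ := by rw [hU, Matrix.mul_one, Matrix.mul_assoc U, Matrix.diagonal_mul_diagonal]
  have tr : ∀ a : β → ℝ, (U * Matrix.diagonal a * Uᵀ)ᵀ = U * Matrix.diagonal a * Uᵀ := by
    intro a
    simp [Matrix.transpose_mul, Matrix.mul_assoc]
  obtain ⟨G, hG⟩ : ∃ G, G = U * Matrix.diagonal (fun i => (D i)⁻¹) * Uᵀ := ⟨_, rfl⟩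
  have hGt : Gᵀ = G := by rw [hG, tr]
  have hGH : (G * (Mᵀ * M))ᵀ = G * (Mᵀ * M) := by rw [hG, hD, key, tr]
  have hGHG : G * (Mᵀ * M) * G = G := by
    rw [hG, hD, key, key]
    congr 3
    funext i
    by_cases h : D i = 0
    · simp [h]
    · field_simp
  have hHGH : Mᵀ * M * (G * (Mᵀ * M)) = Mᵀ * M := by
    rw [hG, hD, key, key]
    congr 3
    funext i
    by_cases h : D i = 0
    · simp [h]
    · field_simp
  have hW : M * (G * (Mᵀ * M) - 1) = 0 := by
    have : (M * (G * (Mᵀ * M) - 1))ᵀ * (M * (G * (Mᵀ * M) - 1)) = 0 := by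
      rw [Matrix.transpose_mul, Matrix.mul_assoc, ← Matrix.mul_assoc Mᵀ, Matrix.mul_sub, hHGH,
        Matrix.mul_one, sub_self, Matrix.mul_zero]
    rw [← Matrix.conjTranspose_eq_transpose_of_trivial] at this
    exact Matrix.conjTranspose_mul_self_eq_zero.mp this
  rw [Matrix.mul_sub, Matrix.mul_one, sub_eq_zero] at hW
  refine ⟨G * Mᵀ, ?_, ?_, ?_, ?_⟩
  · rw [Matrix.mul_assoc, Matrix.mul_assoc G, hW]
  · calc G * Mᵀ * M * (G * Mᵀ) = (G * (Mᵀ * M) * G) * Mᵀ := by simp only [Matrix.mul_assoc]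
      _ = G * Mᵀ := by rw [hGHG]
  · simp [Matrix.transpose_mul, hGt, Matrix.mul_assoc]
  · rw [Matrix.mul_assoc, hGH]

/-- The Moore-Penrose pseudoinverse `M⁺`: the unique solution of the Penrose equations. -/
def pinv {α β : Type*} [Fintype α] [Fintype β] (M : Matrix α β ℝ) : Matrix β α ℝ :=
  Classical.choose (exists_isMoorePenrose M)

theorem pinv_spec {α β : Type*} [Fintype α] [Fintype β] (M : Matrix α β ℝ) :
    IsMoorePenrose M (pinv M) :=
  Classical.choose_spec (exists_isMoorePenrose M)

/-! ### Lie derivatives and vector relative degree -/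

/-- The state space `ℝⁿ` with the Euclidean norm. -/
abbrev E (n : ℕ) := EuclideanSpace ℝ (Fin n)

/-- The Lie derivative `L_f φ = (∂φ/∂x) f`. -/
def lieF {n : ℕ} (f : E n → E n) (φ : E n → ℝ) : E n → ℝ :=
  fun x => fderiv ℝ φ x (f x)

/-- The row vector `L_G φ = (∂φ/∂x) G`. -/
def lieG {n m : ℕ} (G : E n → Matrix (Fin n) (Fin m) ℝ) (φ : E n → ℝ) (x : E n) : Fin m → ℝ :=
  fun b => fderiv ℝ φ x (WithLp.toLp 2 fun a => G x a b)

/-- `ẋ = f(x) + G(x)u`, `y = h(x)` has the vector relative degree `r` at `x₀`. -/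
structure HasVectorRelativeDegree {n m : ℕ} {ι : Type*} [Fintype ι]
    (f : E n → E n) (G : E n → Matrix (Fin n) (Fin m) ℝ) (h : ι → E n → ℝ)
    (r : ι → ℕ) (x₀ : E n) : Prop where
  pos : ∀ o, 1 ≤ r o
  vanish : ∀ o j, j + 2 ≤ r o → ∀ᶠ x in 𝓝 x₀, lieG G ((lieF f)^[j] (h o)) x = 0
  nonsing : (Matrix.of fun o => lieG G ((lieF f)^[r o - 1] (h o)) x₀).rank = Fintype.card ι

/-! ### Systems with prioritized tasks -/

/-- Index set of all scalar outputs: `⟨i, j⟩` is the `j`-th component of the `i`-th task. -/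
abbrev Out {k : ℕ} (p : Fin k → ℕ) := Σ i : Fin k, Fin (p i)

/-- Index set of the coordinates of `ξ = col(ξ_1, …, ξ_k)`: the coordinate `⟨⟨i, j⟩, l⟩`
is `L_f^l h_ij`, `0 ≤ l < r_ij`. -/
abbrev Xi {k : ℕ} {p : Fin k → ℕ} (r : Out p → ℕ) := Σ o : Out p, Fin (r o)

/-- Index set of the coordinates of `ξ_0 = col(ξ_1, …, ξ_{i₀})`. -/
abbrev Xi0 {k : ℕ} {p : Fin k → ℕ} (r : Out p → ℕ) (i₀ : ℕ) :=
  {s : Xi r // s.1.1.val < i₀}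

/-- Data of `ẋ = f(x) + G(x)u`, `y_i = h_i(x)`, `1 ≤ i ≤ k`, with `y_i ∈ ℝ^{p_i}`, together with
the candidate relative degrees `r_ij`.  Task `i` has higher priority than task `j` if `i < j`. -/
structure TaskSystem (n m k : ℕ) (p : Fin k → ℕ) where
  f : E n → E n
  G : E n → Matrix (Fin n) (Fin m) ℝ
  h : Out p → E n → ℝ
  r : Out p → ℕ

namespace TaskSystem

variable {n m k : ℕ} {p : Fin k → ℕ} (S : TaskSystem n m k p)

/-- `L_f^j h_o`. -/
def lieH (o : Out p) (j : ℕ) : E n → ℝ := (lieF S.f)^[j] (S.h o)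

/-- The input gain matrix `J = col(J_1, …, J_k)`. -/
def J (x : E n) : Matrix (Out p) (Fin m) ℝ :=
  Matrix.of fun o => lieG S.G (S.lieH o (S.r o - 1)) x

/-- `κ = col(κ_1, …, κ_k)`, `κ_ij = L_f^{r_ij} h_ij`. -/
def kappa (x : E n) : Out p → ℝ := fun o => S.lieH o (S.r o) x

/-- `ξ = col(ξ_1, …, ξ_k)` as a function of `x`. -/
def xi (x : E n) : Xi S.r → ℝ := fun s => S.lieH s.1 s.2 x

/-- The block `J_i`. -/
def Jblk (x : E n) (i : Fin k) : Matrix (Fin (p i)) (Fin m) ℝ :=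
  (S.J x).submatrix (fun a => ⟨i, a⟩) id

/-- `J_{1:c}`: the rows of `J` of the first `c` tasks. -/
def Jinit (x : E n) (c : ℕ) : Matrix {o : Out p // o.1.val < c} (Fin m) ℝ :=
  (S.J x).submatrix Subtype.val id

/-- The null-space projector `N_{1:c} = I - J_{1:c}⁺ J_{1:c}` (so `N_{1:0} = I`). -/
def Ninit (x : E n) (c : ℕ) : Matrix (Fin m) (Fin m) ℝ :=
  1 - pinv (S.Jinit x c) * S.Jinit x c

/-- `N = I - J⁺ J`. -/
def N (x : E n) : Matrix (Fin m) (Fin m) ℝ := 1 - pinv (S.J x) * S.J x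

/-- The projector `P_i = (J_i N_{1:i-1})⁺ (J_i N_{1:i-1})`; exactly the `i.val` first tasks have
higher priority than task `i`. -/
def P (x : E n) (i : Fin k) : Matrix (Fin m) (Fin m) ℝ :=
  pinv (S.Jblk x i * S.Ninit x i.val) * (S.Jblk x i * S.Ninit x i.val)

/-- `ρ_i(x) = rank P_i(x)`. -/
def rho (x : E n) (i : Fin k) : ℕ := (S.P x i).rank

/-- Standing assumptions on the system and on the open neighbourhood `D` of the origin: sufficient
smoothness, equilibrium at the origin, prioritizability at `0`, and validity on all of `D` of the
rank condition on `G` and of the vanishing conditions of the relative degrees. -/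
structure Prioritizable (D : Set (E n)) : Prop where
  p_le : ∀ i, p i ≤ m
  m_le : m ≤ n
  smooth : ∃ q : ℕ, (∀ o, S.r o ≤ q) ∧ ContDiff ℝ q S.f ∧
    (∀ a b, ContDiff ℝ q fun x => S.G x a b) ∧ ∀ o, ContDiff ℝ q (S.h o)
  f_zero : S.f 0 = 0
  h_zero : ∀ o, S.h o 0 = 0
  rank_zero : (S.G 0).rank = m
  relDegree : ∀ i : Fin k,
    HasVectorRelativeDegree S.f S.G (fun j => S.h ⟨i, j⟩) (fun j => S.r ⟨i, j⟩) 0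
  isOpen_D : IsOpen D
  zero_mem_D : (0 : E n) ∈ D
  rank_D : ∀ x ∈ D, (S.G x).rank = m
  vanish_D : ∀ o j, j + 2 ≤ S.r o → ∀ x ∈ D, lieG S.G (S.lieH o j) x = 0

/-- `Ω_{1:c} = {x ∈ D : ρ_{1:c}(x) = p_{1:c}}`. -/
def Omega (D : Set (E n)) (c : ℕ) : Set (E n) :=
  {x ∈ D | ∑ i : Fin k with i.val < c, S.rho x i = ∑ i : Fin k with i.val < c, p i}

/-- `(L, Q)` is a prioritized orthogonalization of `J` at `x`: `J = LQ` with `L` block lower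
triangular with blocks `L_ij ∈ ℝ^{p_i × ρ_j(x)}`, `Q` with orthonormal rows and row blocks
`Q_j ∈ ℝ^{ρ_j(x) × m}`, and `J_i P_j = L_ij Q_j`, `P_j = Q_jᵀ Q_j`. -/
structure IsOrthogonalization (x : E n)
    (L : Matrix (Out p) (Σ j : Fin k, Fin (S.rho x j)) ℝ)
    (Q : Matrix (Σ j : Fin k, Fin (S.rho x j)) (Fin m) ℝ) : Prop where
  lower : ∀ i j a b, i < j → L ⟨i, a⟩ ⟨j, b⟩ = 0
  orthonormal : Q * Qᵀ = 1
  fac : S.J x = L * Q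
  proj : ∀ j, S.P x j = (Q.submatrix (fun b => ⟨j, b⟩) id)ᵀ * Q.submatrix (fun b => ⟨j, b⟩) id
  blk : ∀ i j, S.Jblk x i * S.P x j =
    L.submatrix (fun a => ⟨i, a⟩) (fun b => ⟨j, b⟩) * Q.submatrix (fun b => ⟨j, b⟩) id

/-- The chains of integrators: `A = diag(A_1, …, A_k)`. -/
def A : Matrix (Xi S.r) (Xi S.r) ℝ :=
  Matrix.blockDiagonal' fun o =>
    Matrix.of fun a b : Fin (S.r o) => if a.val + 1 = b.val then 1 else 0

/-- The chains of integrators: `B = diag(B_1, …, B_k)`. -/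
def B : Matrix (Xi S.r) (Out p) ℝ :=
  Matrix.of fun s o => if s.1 = o ∧ s.2.val + 1 = S.r s.1 then 1 else 0

end TaskSystem

/-! ### Krasovskii regularization -/

/-- The Krasovskii regularization `⋂_{δ > 0} cl co g(x + δ cl(B))` of a map `g` with domain
`dom`. -/
def krasovskii {X Y : Type*} [PseudoMetricSpace X] [NormedAddCommGroup Y] [NormedSpace ℝ Y]
    (dom : Set X) (g : X → Y) (x : X) : Set Y :=
  ⋂ δ : {δ : ℝ // 0 < δ}, closure (convexHull ℝ (g '' (Metric.closedBall x δ ∩ dom)))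

/-! ### The prioritized tracking controller and the closed loop -/

/-- The space of `z_0 = (η_0, ξ_0)`, with `η_0 ∈ ℝ^d`. -/
abbrev ZSpace {k : ℕ} {p : Fin k → ℕ} (r : Out p → ℕ) (i₀ d : ℕ) :=
  EuclideanSpace ℝ (Fin d ⊕ Xi0 r i₀)

/-- Data of the prioritized output tracking problem. -/
structure TrackingDesign {n m k : ℕ} {p : Fin k → ℕ} (S : TaskSystem n m k p) (d : ℕ) where
  /-- the neighbourhood of the origin on which the prioritized normal form is considered -/
  D : Set (E n)
  /-- number of high-priority tasks -/
  i₀ : ℕ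
  /-- the coordinate change `Φ_0 : D_0 → Φ_0(D_0)`, `D_0 = Φ₀.source` -/
  Φ₀ : OpenPartialHomeomorph (E n) (ZSpace S.r i₀ d)
  /-- the compact region of interest in the coordinates `z_0` -/
  C₀ : Set (ZSpace S.r i₀ d)
  /-- the factors of the orthogonalization -/
  L : ∀ x : E n, Matrix (Out p) (Σ j : Fin k, Fin (S.rho x j)) ℝ
  Q : ∀ x : E n, Matrix (Σ j : Fin k, Fin (S.rho x j)) (Fin m) ℝ
  /-- the gain of the prioritized linearizer -/
  Γ : E n → Matrix (Out p) (Out p) ℝ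
  /-- the linear tracking gains `K_i ∈ ℝ^{p_i × r_i}`, `r_i = r_i1 + ⋯ + r_ip_i` -/
  K : ∀ i : Fin k, Matrix (Fin (p i)) (Σ j : Fin (p i), Fin (S.r ⟨i, j⟩)) ℝ
  /-- the free variable `u_f(t, x)` -/
  uf : ℝ → E n → Fin m → ℝ
  /-- the reference signals, used on `[0, ∞)` -/
  yref : Out p → ℝ → ℝ

namespace TrackingDesign

variable {n m k d : ℕ} {p : Fin k → ℕ} {S : TaskSystem n m k p} (T : TrackingDesign S d)

/-- `L_D = diag(L_11, …, L_kk)`. -/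
def LD (x : E n) : Matrix (Out p) (Σ j : Fin k, Fin (S.rho x j)) ℝ :=
  Matrix.blockDiagonal' (Matrix.blockDiag' (T.L x))

/-- `L_ii L_iiᵀ Γ_ii`. -/
def LLΓ (x : E n) (i : Fin k) : Matrix (Fin (p i)) (Fin (p i)) ℝ :=
  Matrix.blockDiag' (T.L x) i * (Matrix.blockDiag' (T.L x) i)ᵀ * Matrix.blockDiag' (T.Γ x) i

/-- The prioritized linearizer `u^π = Qᵀ L_Dᵀ Γ (v - κ) + N u_f`. -/
def upi (x : E n) (v : Out p → ℝ) (w : Fin m → ℝ) : Fin m → ℝ :=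
  ((T.Q x)ᵀ * (T.LD x)ᵀ * T.Γ x) *ᵥ (v - S.kappa x) + S.N x *ᵥ w

/-- The residual matrix `E = I - L L_Dᵀ Γ`. -/
def resid (x : E n) : Matrix (Out p) (Out p) ℝ := 1 - T.L x * (T.LD x)ᵀ * T.Γ x

/-- `ξ^⋆(t)`: the derivatives `y_ij^{⋆(l)}(t)`, `0 ≤ l < r_ij`. -/
def xiRef (t : ℝ) : Xi S.r → ℝ := fun s => iteratedDerivWithin s.2 (T.yref s.1) (Ici 0) t

/-- `κ^⋆(t)`: the derivatives `y_ij^{⋆(r_ij)}(t)`. -/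
def kappaRef (t : ℝ) : Out p → ℝ := fun o => iteratedDerivWithin (S.r o) (T.yref o) (Ici 0) t

/-- The linear control law `v_i = -K_i (ξ_i - ξ_i^⋆) + κ_i^⋆`. -/
def v (t : ℝ) (x : E n) : Out p → ℝ := fun o =>
  -(T.K o.1 *ᵥ fun s => S.xi x ⟨⟨o.1, s.1⟩, s.2⟩ - T.xiRef t ⟨⟨o.1, s.1⟩, s.2⟩) o.2
    + T.kappaRef t o

/-- The `η_0`-components of `Φ_0`. -/
def phiEta (a : Fin d) : E n → ℝ := fun x => T.Φ₀ x (Sum.inl a)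

/-- `f_0 = L_f φ_η`. -/
def f₀ (x : E n) : Fin d → ℝ := fun a => lieF S.f (T.phiEta a) x

/-- `G_0 = L_G φ_η`. -/
def G₀ (x : E n) : Matrix (Fin d) (Fin m) ℝ := Matrix.of fun a => lieG S.G (T.phiEta a) x

/-- Right-hand side `f_0 + G_0 u^π` of the closed-loop `η_0`-dynamics as a function of
`(t, z_0)`. -/
def etaRhs (t : ℝ) (z : ZSpace S.r T.i₀ d) : Fin d → ℝ :=
  let x := T.Φ₀.symm z
  T.f₀ x + T.G₀ x *ᵥ T.upi x (T.v t x) (T.uf t x)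

/-- Right-hand side `A ξ + B v - B E (v - κ)` of the closed-loop `ξ`-dynamics as a function of
`(t, z_0)`. -/
def xiRhs (t : ℝ) (z : ZSpace S.r T.i₀ d) : Xi S.r → ℝ :=
  let x := T.Φ₀.symm z
  S.A *ᵥ S.xi x + S.B *ᵥ (T.v t x - T.resid x *ᵥ (T.v t x - S.kappa x))

/-- The right-hand side of the closed-loop differential inclusion: the `η_0`-part is Krasovskii
regularized, the `ξ_0`-part is single-valued. -/
def inclusion (t : ℝ) (z : ZSpace S.r T.i₀ d) : Set (ZSpace S.r T.i₀ d) :=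
  {w | (fun a => w (Sum.inl a)) ∈ krasovskii T.Φ₀.target (T.etaRhs t) z ∧
    ∀ s : Xi0 S.r T.i₀, w (Sum.inr s) = T.xiRhs t z s.1}

/-- The standing assumptions. -/
structure Standing : Prop where
  prioritizable : S.Prioritizable T.D
  orthogonalization : ∀ x ∈ T.D, S.IsOrthogonalization x (T.L x) (T.Q x)
  -- the prioritized linearizer
  Γ_lower : ∀ x ∈ T.D, ∀ i j a b, i < j → T.Γ x ⟨i, a⟩ ⟨j, b⟩ = 0
  Γ_rank : ∀ x ∈ T.D, ∀ i, (T.LLΓ x i).rank = S.rho x i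
  Γ_nonneg : ∀ x ∈ T.D, ∀ i, (T.LLΓ x i + (T.LLΓ x i)ᵀ).PosSemidef
  -- the region of interest
  i₀_pos : 1 ≤ T.i₀
  i₀_le : T.i₀ ≤ k
  dim : d + Fintype.card (Xi0 S.r T.i₀) = n
  D₀_subset : T.Φ₀.source ⊆ S.Omega T.D T.i₀
  zero_mem_D₀ : (0 : E n) ∈ T.Φ₀.source
  Φ₀_zero : T.Φ₀ 0 = 0
  Φ₀_smooth : ContDiffOn ℝ 1 T.Φ₀ T.Φ₀.source
  Φ₀_symm_smooth : ContDiffOn ℝ 1 T.Φ₀.symm T.Φ₀.target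
  Φ₀_xi : ∀ x ∈ T.Φ₀.source, ∀ s : Xi0 S.r T.i₀, T.Φ₀ x (Sum.inr s) = S.xi x s.1
  C₀_compact : IsCompact T.C₀
  C₀_nhds : T.C₀ ∈ 𝓝 0
  C₀_subset : T.C₀ ⊆ T.Φ₀.target
  -- the gain `Γ` on `D_0`
  Γ_pos : ∀ i : Fin k, i.val < T.i₀ → ∃ ς : ℝ, 0 < ς ∧ ∀ z ∈ T.C₀,
    ((1 / 2 : ℝ) • (T.LLΓ (T.Φ₀.symm z) i + (T.LLΓ (T.Φ₀.symm z) i)ᵀ)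
      - ς • (1 : Matrix (Fin (p i)) (Fin (p i)) ℝ)).PosSemidef
  Γ_cont : ∀ o o' : Out p, o.1.val < T.i₀ → o'.1.val < T.i₀ →
    ContinuousOn (fun x => T.Γ x o o') T.Φ₀.source
  Γ_bdd : ∀ s ⊆ T.Φ₀.source, IsCompact s → ∃ M : ℝ, ∀ x ∈ s, ∀ o o', |T.Γ x o o'| ≤ M
  -- the reference signals
  yref_smooth : ∀ o, ContDiffOn ℝ (S.r o) (T.yref o) (Ici 0)
  xiRef_bdd : ∃ M : ℝ, ∀ t, 0 ≤ t → ∀ s, |T.xiRef t s| ≤ M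
  kappaRef_bdd : ∃ M : ℝ, ∀ t, 0 ≤ t → ∀ o, |T.kappaRef t o| ≤ M
  -- the free variable
  uf_meas : ∀ x ∈ T.Φ₀.symm '' T.C₀,
    AEMeasurable (fun t => T.uf t x) (volume.restrict (Ici 0))
  uf_mem : ∃ U : Set (Fin m → ℝ), Convex ℝ U ∧ IsCompact U ∧
    ∀ t, 0 ≤ t → ∀ x ∈ T.Φ₀.symm '' T.C₀, T.uf t x ∈ U

/-- `z` is a Krasovskii solution on `[0, τ)`: it is absolutely continuous on the compact
subintervals of `[0, τ)` and satisfies the differential inclusion at almost all times. -/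
structure IsKrasovskiiSolution (τ : EReal) (z : ℝ → ZSpace S.r T.i₀ d) : Prop where
  absCont : ∀ b : ℝ, 0 ≤ b → (b : EReal) < τ → AbsolutelyContinuousOnInterval z 0 b
  mem : ∀ᵐ t : ℝ, 0 ≤ t → (t : EReal) < τ → ∃ w ∈ T.inclusion t (z t), HasDerivAt z w t

end TrackingDesign

end PriorityControl

end

/-! The closed-loop field is bounded on `C₀` and measurable in time at each fixed state, but it may
jump in the state, so neither Peano nor Carathéodory applies. The Krasovskii set absorbs the jumps.
Euler curves that freeze the state on time cells need only measurability at fixed states. They are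
equi-Lipschitz, so a subsequence converges pointwise (`exists_subseq_tendsto_of_lipschitzWith`). For
a functional `l`, the derivative of the limit satisfies `l z' ≤ sup l(g)` over every tail of the
frozen values, by integration and Lebesgue differentiation (`ae_le_iSup_of_tendsto_primitive`).
Countably many dense `l` and Hahn-Banach then place `z'` in the closed convex hulls, outside a
single null set (`exists_krasovskii_solution`).

Two facts about the controller are needed. Boundedness: `L` and `Q` enter only through the matrix
`JP` of block rows `J_i P_i`, because `L_D Q = JP` and `L L_Dᵀ = J JPᵀ`; orthogonal projectors have
entries at most one in modulus, so `JP` stays bounded where ranks drop. Continuity of the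
`ξ_0`-part: on `Ω_{1:i₀}` the first `i₀` tasks have full row rank, so their projectors are
continuous, and triangularity keeps low-priority terms out of the first `i₀` block rows of `E`. The
regularization of the whole field is therefore single-valued in these components and projects into
the required inclusion.

Setting the field to zero outside `C₀` makes it globally bounded without changing its regularization
at interior points of `C₀`. The resulting global curve is stopped at its first exit from the
interior. -/

noncomputable section

namespace PriorityControl

/-! ### Krasovskii solutions of bounded fields that are only measurable in time -/

section Existence

variable {X : Type*} [NormedAddCommGroup X]

/-- Countability of the index makes the union of the exceptional null sets null. This gives
measurability of a field along a state that is frozen on each time cell. -/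
theorem aestronglyMeasurable_of_nat_index [NormedSpace ℝ X] [FiniteDimensional ℝ X]
    {F : ℕ → ℝ → X} {idx : ℝ → ℕ}
    (hF : ∀ i, AEStronglyMeasurable (F i) volume) (hidx : Measurable idx) :
    AEStronglyMeasurable (fun s => F (idx s) s) volume := by
  borelize X
  have : ProperSpace X := FiniteDimensional.proper ℝ X
  refine AEMeasurable.aestronglyMeasurable
    ⟨fun s => (hF (idx s)).mk (F (idx s)) s, ?_, ?_⟩
  · have h : Measurable fun q : ℝ × ℕ => (hF q.2).mk (F q.2) q.1 :=
      measurable_from_prod_countable_left fun i => (hF i).stronglyMeasurable_mk.measurable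
    exact h.comp (measurable_id.prodMk hidx)
  · filter_upwards [ae_all_iff.2 fun i => (hF i).ae_eq_mk] with s hs using hs (idx s)

theorem intervalIntegrable_of_bound {w : ℝ → X} {M : ℝ}
    (hw : AEStronglyMeasurable w volume) (hM : ∀ s, ‖w s‖ ≤ M) (a b : ℝ) :
    IntervalIntegrable w volume a b := by
  refine (intervalIntegrable_const (c := M)).mono_fun' hw.restrict ?_
  exact Eventually.of_forall hM

theorem lipschitzWith_primitive [NormedSpace ℝ X]
    {w : ℝ → X} {M : ℝ} (z₀ : X)
    (hw : AEStronglyMeasurable w volume) (hM : ∀ s, ‖w s‖ ≤ M) :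
    LipschitzWith M.toNNReal fun t => z₀ + ∫ s in (0 : ℝ)..t, w s := by
  refine LipschitzWith.of_dist_le_mul fun a b => ?_
  have hM0 : 0 ≤ M := (norm_nonneg _).trans (hM 0)
  rw [dist_add_left, dist_comm, dist_eq_norm, intervalIntegral.integral_interval_sub_left
    (intervalIntegrable_of_bound hw hM _ _) (intervalIntegrable_of_bound hw hM _ _),
    Real.coe_toNNReal _ hM0, dist_comm, Real.dist_eq]
  exact intervalIntegral.norm_integral_le_of_norm_le_const fun s _ => hM s

/-- Euler polygons for an equation whose right-hand side is only measurable in time. -/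
theorem exists_euler_polygon [NormedSpace ℝ X] [FiniteDimensional ℝ X]
    {g : ℝ → X → X} {M : ℝ} (hM : ∀ t x, ‖g t x‖ ≤ M)
    (hg : ∀ x, AEStronglyMeasurable (fun t => g t x) volume) (z₀ : X) {h : ℝ} (hh : 0 < h) :
    ∃ ζ : ℝ → X, AEStronglyMeasurable (fun s => g s (ζ s)) volume ∧
      ∀ t, 0 ≤ t → ‖(z₀ + ∫ s in (0 : ℝ)..t, g s (ζ s)) - ζ t‖ ≤ M * h := by
  -- The increment is the exact time integral at the frozen state; sampling the field at a grid time
  -- would be meaningless for a merely measurable dependence on time.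
  obtain ⟨y, hy0, hy⟩ : ∃ y : ℕ → X, y 0 = z₀ ∧
      ∀ i : ℕ, y (i + 1) = y i + ∫ s in (i * h)..((i + 1 : ℕ) * h), g s (y i) :=
    ⟨fun i => Nat.rec z₀ (fun i a => a + ∫ s in (i * h)..((i + 1 : ℕ) * h), g s a) i, rfl,
      fun _ => rfl⟩
  have hmeas : AEStronglyMeasurable (fun s => g s (y ⌊s / h⌋₊)) volume :=
    aestronglyMeasurable_of_nat_index (F := fun i s => g s (y i)) (fun i => hg (y i))
      (Nat.measurable_floor.comp (measurable_id.div_const h))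
  have hint : ∀ a b, IntervalIntegrable (fun s => g s (y ⌊s / h⌋₊)) volume a b :=
    intervalIntegrable_of_bound hmeas fun s => hM _ _
  have hgrid : ∀ i : ℕ, z₀ + ∫ s in (0 : ℝ)..(i * h), g s (y ⌊s / h⌋₊) = y i := by
    intro i
    induction i with
    | zero => simp [hy0]
    | succ i ih =>
      rw [hy, ← intervalIntegral.integral_add_adjacent_intervals (hint 0 (i * h)) (hint _ _),
        ← add_assoc, ih]
      congr 1
      refine intervalIntegral.integral_congr_ae ?_
      -- The right endpoint of the cell is discarded: the floor already jumps to `i + 1` there.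
      filter_upwards [measure_eq_zero_iff_ae_notMem.1
        (measure_singleton (μ := (volume : Measure ℝ)) (((i + 1 : ℕ) : ℝ) * h))] with s hs hs'
      rw [uIoc_of_le (by push_cast; nlinarith)] at hs'
      have : ⌊s / h⌋₊ = i := by
        have h1 : s < ((i + 1 : ℕ) : ℝ) * h := lt_of_le_of_ne hs'.2 hs
        have h0 : (i : ℝ) ≤ s / h := by rw [le_div_iff₀ hh]; exact hs'.1.le
        rw [Nat.floor_eq_iff ((Nat.cast_nonneg i).trans h0)]
        refine ⟨h0, ?_⟩
        rw [div_lt_iff₀ hh]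
        exact_mod_cast h1
      rw [this]
  refine ⟨fun s => y ⌊s / h⌋₊, hmeas, fun t ht => ?_⟩
  have hM0 : 0 ≤ M := (norm_nonneg _).trans (hM 0 z₀)
  have hfl := Nat.floor_le (div_nonneg ht hh.le)
  have hfl' := Nat.lt_floor_add_one (t / h)
  rw [le_div_iff₀ hh] at hfl
  rw [div_lt_iff₀ hh] at hfl'
  have hlip := (lipschitzWith_primitive z₀ hmeas fun s => hM _ _).dist_le_mul t (⌊t / h⌋₊ * h)
  simp only [hgrid] at hlip
  rw [dist_eq_norm, Real.coe_toNNReal _ hM0, Real.dist_eq, abs_of_nonneg (by linarith)] at hlip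
  exact hlip.trans (mul_le_mul_of_nonneg_left (by linarith) hM0)

/-- A sequence of equi-Lipschitz curves with common initial value has a pointwise convergent
subsequence. -/
theorem exists_subseq_tendsto_of_lipschitzWith [NormedSpace ℝ X] [FiniteDimensional ℝ X]
    {M : NNReal} {z : ℕ → ℝ → X} {z₀ : X}
    (hz : ∀ n, LipschitzWith M (z n)) (hz₀ : ∀ n, z n 0 = z₀) :
    ∃ (φ : ℕ → ℕ) (x : ℝ → X), StrictMono φ ∧ ∀ t, Tendsto (fun n => z (φ n) t) atTop (𝓝 (x t)) := by
  have : ProperSpace X := FiniteDimensional.proper ℝ X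
  -- Tychonoff over the countable set `ℚ` replaces a diagonal argument; the common Lipschitz bound
  -- then carries convergence from rational to real times.
  have hK : IsCompact (Set.pi univ fun q : ℚ => Metric.closedBall z₀ (M * ‖q‖)) :=
    isCompact_univ_pi fun q => isCompact_closedBall _ _
  obtain ⟨a, -, φ, hφ, ha⟩ := hK.tendsto_subseq (x := fun n (q : ℚ) => z n q) (fun n q _ => by
    have := (hz n).dist_le_mul q 0
    simpa [hz₀] using this)
  rw [tendsto_pi_nhds] at ha
  have hc : ∀ t, CauchySeq fun n => z (φ n) t := by
    intro t
    rw [Metric.cauchySeq_iff]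
    intro ε hε
    obtain ⟨q, hq⟩ : ∃ q : ℚ, M * |t - q| < ε / 3 := by
      obtain ⟨q, hq1, hq2⟩ := exists_rat_btwn (show t < t + ε / (3 * (M + 1)) by
        have : (0 : ℝ) < 3 * (M + 1) := by positivity
        linarith [div_pos hε this])
      refine ⟨q, ?_⟩
      rw [abs_sub_comm, abs_of_pos (by linarith)]
      have h1 : (q : ℝ) - t < ε / (3 * (M + 1)) := by linarith
      have h2 : (M + 1) * (ε / (3 * (M + 1)) : ℝ) = ε / 3 := by field_simp
      have h3 : (0 : ℝ) ≤ M := M.2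
      nlinarith
    obtain ⟨n₀, hn₀⟩ := Metric.cauchySeq_iff.1 (ha q).cauchySeq (ε / 3) (by positivity)
    refine ⟨n₀, fun i hi j hj => ?_⟩
    have h1 := (hz (φ i)).dist_le_mul t q
    have h2 := (hz (φ j)).dist_le_mul q t
    have h3 := hn₀ i hi j hj
    rw [Real.dist_eq] at h1
    rw [dist_comm (q : ℝ), Real.dist_eq] at h2
    have h4 := dist_triangle4 (z (φ i) t) (z (φ i) q) (z (φ j) q) (z (φ j) t)
    simp only [Function.comp_apply] at h3
    linarith
  choose x hx using fun t => cauchySeq_tendsto_of_complete (hc t)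
  exact ⟨φ, x, hφ, hx⟩

/-- A point outside the closed hull is strictly separated from it. Since `A` is bounded, the
separation survives a small perturbation of the functional, so a dense family suffices; a countable
one later costs only one null set. -/
theorem mem_closure_convexHull_of_dense [NormedSpace ℝ X]
    {A : Set X} {R : ℝ} (hA : ∀ a ∈ A, ‖a‖ ≤ R)
    {ι : Type*} {l : ι → StrongDual ℝ X} (hl : DenseRange l) {w : X}
    (hw : ∀ i c, (∀ a ∈ A, l i a ≤ c) → l i w ≤ c) : w ∈ closure (convexHull ℝ A) := by
  by_contra hmem
  obtain ⟨f, u, hfu, hfw⟩ := geometric_hahn_banach_closed_point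
    (convex_convexHull ℝ A).closure isClosed_closure hmem
  -- `|R|` covers an empty `A` with negative `R`, and the `1` keeps the divisor positive.
  have hpos : 0 < |R| + ‖w‖ + 1 := by positivity
  obtain ⟨i, hi⟩ := hl.exists_dist_lt f (div_pos (sub_pos.2 hfw) hpos)
  rw [dist_eq_norm] at hi
  have hgap : ‖f - l i‖ * (|R| + ‖w‖ + 1) < f w - u := by rwa [lt_div_iff₀ hpos] at hi
  have hf0 := norm_nonneg (f - l i)
  have h1 := hw i (u + ‖f - l i‖ * |R|) fun a ha => by
    have h2 := hfu a (subset_closure (subset_convexHull ℝ A ha))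
    have h3 := (f - l i).le_opNorm a
    have h4 : ‖f - l i‖ * ‖a‖ ≤ ‖f - l i‖ * |R| :=
      mul_le_mul_of_nonneg_left ((hA a ha).trans (le_abs_self R)) hf0
    have h5 := neg_abs_le ((f - l i) a)
    rw [← Real.norm_eq_abs, _root_.sub_apply] at h5
    rw [_root_.sub_apply] at h3
    linarith
  have h3 := (f - l i).le_opNorm w
  have h5 := le_abs_self ((f - l i) w)
  rw [← Real.norm_eq_abs, _root_.sub_apply] at h5
  rw [_root_.sub_apply] at h3
  nlinarith

/-- A linear functional of the derivative of a pointwise limit of primitives is bounded by the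
supremum of its values at the integrands. -/
theorem ae_le_iSup_of_tendsto_primitive [NormedSpace ℝ X] [CompleteSpace X]
    {w : ℕ → ℝ → X} {M : ℝ} {z₀ : X} {z : ℝ → X}
    (hw : ∀ n, AEStronglyMeasurable (w n) volume) (hM : ∀ n s, ‖w n s‖ ≤ M)
    (hz : ∀ t, Tendsto (fun n => z₀ + ∫ s in (0 : ℝ)..t, w n s) atTop (𝓝 (z t)))
    (l : StrongDual ℝ X) :
    ∀ᵐ t, ∀ z', HasDerivAt z z' t → l z' ≤ ⨆ n, l (w n t) := by
  borelize X
  have hb : ∀ n s, |l (w n s)| ≤ ‖l‖ * M := fun n s => by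
    rw [← Real.norm_eq_abs]
    exact (l.le_opNorm _).trans (mul_le_mul_of_nonneg_left (hM n s) (norm_nonneg _))
  have hbdd : ∀ s, BddAbove (range fun n => l (w n s)) := fun s =>
    ⟨‖l‖ * M, by rintro _ ⟨n, rfl⟩; exact (le_abs_self _).trans (hb n s)⟩
  obtain ⟨ψ, hψ⟩ : ∃ ψ : ℝ → ℝ, ψ = fun s => ⨆ n, l (w n s) := ⟨_, rfl⟩
  have hψm : AEStronglyMeasurable ψ volume := by
    rw [hψ]
    exact (AEMeasurable.iSup fun n =>
      (l.continuous.comp_aestronglyMeasurable (hw n)).aemeasurable).aestronglyMeasurable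
  have hψb : ∀ s, ‖ψ s‖ ≤ ‖l‖ * M := fun s => by
    rw [hψ, Real.norm_eq_abs, abs_le]
    exact ⟨(neg_le_of_abs_le (hb 0 s)).trans (le_ciSup (hbdd s) 0),
      ciSup_le fun n => (le_abs_self _).trans (hb n s)⟩
  have hψi : ∀ a b, IntervalIntegrable ψ volume a b := intervalIntegrable_of_bound hψm hψb
  -- The bound is integrated before the limit is taken: `∫ ψ - l z` inherits monotonicity from the
  -- approximants, although their derivatives need not converge.
  have hmono : Monotone fun t => (∫ s in (0 : ℝ)..t, ψ s) - l (z t) := by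
    intro a b hab
    have hlim : ∀ t, Tendsto (fun n => l (z₀ + ∫ s in (0 : ℝ)..t, w n s)) atTop (𝓝 (l (z t))) :=
      fun t => (l.continuous.tendsto _).comp (hz t)
    have hle : l (z b) - l (z a) ≤ ∫ s in a..b, ψ s := by
      refine le_of_tendsto ((hlim b).sub (hlim a)) (Eventually.of_forall fun n => ?_)
      have hi := intervalIntegrable_of_bound (hw n) (hM n)
      rw [← map_sub, add_sub_add_left_eq_sub,
        intervalIntegral.integral_interval_sub_left (hi _ _) (hi _ _),
        ← l.intervalIntegral_comp_comm (hi a b)]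
      refine intervalIntegral.integral_mono_on hab ?_ (hψi a b) fun s _ => ?_
      · exact intervalIntegrable_of_bound (M := ‖l‖ * M)
          (l.continuous.comp_aestronglyMeasurable (hw n)) (hb n) a b
      · rw [hψ]; exact le_ciSup (hbdd s) n
    rw [← intervalIntegral.integral_interval_sub_left (hψi 0 b) (hψi 0 a)] at hle
    show (∫ s in (0 : ℝ)..a, ψ s) - l (z a) ≤ (∫ s in (0 : ℝ)..b, ψ s) - l (z b)
    linarith
  have hloc : LocallyIntegrable ψ volume :=
    (locallyIntegrable_const (‖l‖ * M)).mono hψm (Eventually.of_forall fun s =>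
      (hψb s).trans (le_abs_self _))
  filter_upwards [LocallyIntegrable.ae_hasDerivAt_integral hloc] with t ht z' hz'
  have hd := (ht 0).sub (l.hasFDerivAt.comp_hasDerivAt t hz')
  have h0 : 0 ≤ deriv (fun t => (∫ s in (0 : ℝ)..t, ψ s) - l (z t)) t := hmono.deriv_nonneg
  have h1 : deriv (fun t => (∫ s in (0 : ℝ)..t, ψ s) - l (z t)) t = ψ t - l z' := hd.deriv
  rw [h1, hψ] at h0
  exact sub_nonneg.1 h0

/-- Existence of solutions of the Krasovskii regularization of a bounded right-hand side that is
measurable in time. -/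
theorem exists_krasovskii_solution [NormedSpace ℝ X] [FiniteDimensional ℝ X]
    {g : ℝ → X → X} {M : ℝ} (hM : ∀ t x, ‖g t x‖ ≤ M)
    (hg : ∀ x, AEStronglyMeasurable (fun t => g t x) volume) (z₀ : X) :
    ∃ z : ℝ → X, z 0 = z₀ ∧ LipschitzWith M.toNNReal z ∧
      ∀ᵐ t, 0 ≤ t → ∃ w ∈ krasovskii univ (g t) (z t), HasDerivAt z w t := by
  have : CompleteSpace X := FiniteDimensional.complete ℝ X
  choose ζ hζm hζ using fun n : ℕ => exists_euler_polygon hM hg z₀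
    (h := 1 / ((n : ℝ) + 1)) (by positivity)
  obtain ⟨φ, z, hφ, hz⟩ := exists_subseq_tendsto_of_lipschitzWith
    (fun n => lipschitzWith_primitive z₀ (hζm n) fun s => hM _ _) (z₀ := z₀) (fun n => by simp)
  have hzlip : LipschitzWith M.toNNReal z := by
    refine LipschitzWith.of_dist_le_mul fun a b => ?_
    exact le_of_tendsto ((hz a).dist (hz b)) (Eventually.of_forall fun n =>
      (lipschitzWith_primitive z₀ (hζm _) fun s => hM _ _).dist_le_mul a b)
  have hζlim : ∀ t, 0 ≤ t → Tendsto (fun n => ζ (φ n) t) atTop (𝓝 (z t)) := by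
    intro t ht
    have h0 : Tendsto (fun n => M * (1 / ((φ n : ℝ) + 1))) atTop (𝓝 0) := by
      simpa using (tendsto_one_div_add_atTop_nhds_zero_nat.comp hφ.tendsto_atTop).const_mul M
    have h1 := squeeze_zero_norm (fun n => hζ (φ n) t ht) h0
    simpa using (hz t).sub h1
  have hsep : ∃ l : ℕ → StrongDual ℝ X, DenseRange l := by
    have : ProperSpace (StrongDual ℝ X) := FiniteDimensional.proper ℝ _
    exact ⟨TopologicalSpace.denseSeq _, TopologicalSpace.denseRange_denseSeq _⟩
  obtain ⟨l, hl⟩ := hsep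
  -- Every tail of the sequence is needed, since only late frozen states lie within `δ` of `z t`;
  -- the pairs `(i, K)` are countable.
  have hae : ∀ᵐ t, ∀ i K : ℕ, ∀ z', HasDerivAt z z' t →
      l i z' ≤ ⨆ n, l i (g t (ζ (φ (n + K)) t)) := by
    rw [ae_all_iff]; intro i
    rw [ae_all_iff]; intro K
    exact ae_le_iSup_of_tendsto_primitive (fun n => hζm _) (fun n s => hM _ _)
      (fun t => (hz t).comp (tendsto_add_atTop_nat K)) (l i)
  refine ⟨z, tendsto_nhds_unique (hz 0) (by simp), hzlip, ?_⟩
  filter_upwards [hzlip.ae_differentiableAt_real, hae] with t hd ht ht0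
  refine ⟨deriv z t, ?_, hd.hasDerivAt⟩
  rw [krasovskii, mem_iInter]
  rintro ⟨δ, hδ⟩
  refine mem_closure_convexHull_of_dense (R := M) (by rintro _ ⟨x, -, rfl⟩; exact hM _ _) hl
    fun i c hc => ?_
  obtain ⟨K, hK⟩ := eventually_atTop.1
    ((hζlim t ht0).eventually (Metric.closedBall_mem_nhds (z t) hδ))
  refine (ht i K _ hd.hasDerivAt).trans (ciSup_le fun n => hc _ ⟨_, ⟨hK _ ?_, mem_univ _⟩, rfl⟩)
  exact Nat.le_add_left _ _

end Existence

/-! ### Orthogonal projectors and continuity of the pseudoinverse at full row rank -/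

section Projections

variable {α β : Type*} [Fintype α] [Fintype β]

/-- Symmetry and idempotence give `P a a = ∑ c, P a c ^ 2`. Hence `P a a ≤ 1`, and then `P a b ^ 2 ≤
P a a`. No rank condition enters, so the bound is uniform in the state. -/
theorem abs_apply_le_one_of_projection {P : Matrix β β ℝ} (hs : Pᵀ = P) (hi : P * P = P)
    (a b : β) : |P a b| ≤ 1 := by
  have hdiag : ∑ c, P a c * P a c = P a a := by
    conv_rhs => rw [← hi, Matrix.mul_apply]
    exact Finset.sum_congr rfl fun c _ => by rw [← Matrix.transpose_apply P c a, hs]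
  have hle : ∀ c, P a c * P a c ≤ P a a := fun c => by
    rw [← hdiag]
    exact Finset.single_le_sum (f := fun c => P a c * P a c)
      (fun c _ => mul_self_nonneg _) (Finset.mem_univ c)
  have h1 := hle a
  have h2 := hle b
  have h3 : P a a ≤ 1 := by nlinarith
  rw [← sq_le_one_iff_abs_le_one]
  nlinarith

theorem pinv_mul_self_projection (M : Matrix α β ℝ) :
    (pinv M * M)ᵀ = pinv M * M ∧ (pinv M * M) * (pinv M * M) = pinv M * M :=
  ⟨(pinv_spec M).symm_right, by rw [← Matrix.mul_assoc, (pinv_spec M).mul_mul']⟩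

theorem one_sub_pinv_mul_self_projection [DecidableEq β] (M : Matrix α β ℝ) :
    (1 - pinv M * M)ᵀ = 1 - pinv M * M ∧
      (1 - pinv M * M) * (1 - pinv M * M) = 1 - pinv M * M := by
  obtain ⟨h1, h2⟩ := pinv_mul_self_projection M
  refine ⟨by rw [Matrix.transpose_sub, h1, Matrix.transpose_one], ?_⟩
  rw [Matrix.mul_sub, Matrix.sub_mul, Matrix.sub_mul, h2]
  simp

theorem rank_pinv_mul_self (M : Matrix α β ℝ) : (pinv M * M).rank = M.rank := by
  refine le_antisymm (Matrix.rank_mul_le_right _ _) ?_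
  conv_lhs => rw [← (pinv_spec M).mul_mul, Matrix.mul_assoc]
  exact Matrix.rank_mul_le_right _ _

theorem vecMul_injective_of_rank {M : Matrix α β ℝ} (h : M.rank = Fintype.card α) :
    Function.Injective M.vecMul := by
  rw [Matrix.vecMul_injective_iff, linearIndependent_iff_card_eq_finrank_span, ← h,
    Matrix.rank_eq_finrank_span_row]
  rfl

theorem isUnit_det_mul_transpose [DecidableEq α] {M : Matrix α β ℝ}
    (h : Function.Injective M.vecMul) : IsUnit (M * Mᵀ).det := by
  rw [← Matrix.isUnit_iff_isUnit_det, ← Matrix.vecMul_injective_iff_isUnit]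
  refine (injective_iff_map_eq_zero (Matrix.vecMulLinear (M * Mᵀ))).2 fun v hv => ?_
  have h0 : (v ᵥ* M) ⬝ᵥ (v ᵥ* M) = 0 := by
    have h1 : v ᵥ* (M * Mᵀ) = 0 := hv
    rw [← Matrix.vecMul_vecMul, Matrix.vecMul_transpose] at h1
    rw [← Matrix.dotProduct_mulVec, h1, dotProduct_zero]
  exact h ((dotProduct_self_eq_zero.1 h0).trans (Matrix.zero_vecMul M).symm)

theorem pinv_eq_of_vecMul_injective [DecidableEq α] {M : Matrix α β ℝ}
    (h : Function.Injective M.vecMul) : pinv M = Mᵀ * (M * Mᵀ)⁻¹ := by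
  have hu := isUnit_det_mul_transpose h
  have h1 : M * (Mᵀ * (M * Mᵀ)⁻¹) = 1 := by
    rw [← Matrix.mul_assoc, Matrix.mul_nonsing_inv _ hu]
  refine (pinv_spec M).unique ⟨by rw [h1, Matrix.one_mul], ?_, by rw [h1, Matrix.transpose_one], ?_⟩
  · rw [Matrix.mul_assoc, h1, Matrix.mul_one]
  · rw [Matrix.transpose_mul, Matrix.transpose_mul, Matrix.transpose_nonsing_inv,
      Matrix.transpose_mul, Matrix.transpose_transpose, Matrix.mul_assoc]

/-- The pseudoinverse jumps where the rank does; at full row rank it is `Mᵀ (M Mᵀ)⁻¹`, which is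
continuous. -/
theorem continuousOn_pinv {Y : Type*} [TopologicalSpace Y] {s : Set Y} {M : Y → Matrix α β ℝ}
    (hM : ContinuousOn M s) (h : ∀ y ∈ s, Function.Injective (M y).vecMul) :
    ContinuousOn (fun y => pinv (M y)) s := by
  classical
  have hc : ContinuousOn (fun y => (M y)ᵀ * (M y * (M y)ᵀ)⁻¹) s := by
    have hT : ContinuousOn (fun y => (M y)ᵀ) s := continuous_id.matrix_transpose.comp_continuousOn hM
    have hMT : ContinuousOn (fun y => M y * (M y)ᵀ) s :=
      (continuous_fst.matrix_mul continuous_snd).comp_continuousOn (hM.prodMk hT)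
    have hinv : ContinuousOn (fun y => (M y * (M y)ᵀ)⁻¹) s := fun y hy =>
      (continuousAt_matrix_inv _ (by
        rw [Ring.inverse_eq_inv']
        exact continuousAt_inv₀ (isUnit_det_mul_transpose (h y hy)).ne_zero)).comp_continuousWithinAt
        (hMT y hy)
    exact (continuous_fst.matrix_mul continuous_snd).comp_continuousOn (hT.prodMk hinv)
  exact hc.congr fun y hy => pinv_eq_of_vecMul_injective (h y hy)

theorem continuousOn_matrix_mul {Y α β γ : Type*} [Fintype β] [TopologicalSpace Y] {s : Set Y}
    {M : Y → Matrix α β ℝ} {N : Y → Matrix β γ ℝ} (hM : ContinuousOn M s)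
    (hN : ContinuousOn N s) : ContinuousOn (fun y => M y * N y) s :=
  (continuous_fst.matrix_mul continuous_snd).comp_continuousOn (hM.prodMk hN)

end Projections

/-! ### Regularity of iterated Lie derivatives -/

section Smoothness

variable {n m : ℕ}

/-- Each Lie derivative costs one order of smoothness. -/
theorem contDiff_lieF_iterate {f : E n → E n} {φ : E n → ℝ} {q : ℕ}
    (hf : ContDiff ℝ q f) (hφ : ContDiff ℝ q φ) :
    ∀ j s : ℕ, s + j ≤ q → ContDiff ℝ s ((lieF f)^[j] φ) := by
  intro j
  induction j with
  | zero => intro s hs; exact hφ.of_le (by exact_mod_cast hs)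
  | succ j ih =>
    intro s hs
    rw [Function.iterate_succ_apply']
    have h1 : ContDiff ℝ (s + 1 : ℕ) ((lieF f)^[j] φ) := ih (s + 1) (by omega)
    exact (h1.fderiv_right (m := s) (by norm_cast)).clm_apply
      (hf.of_le (by exact_mod_cast (by omega : s ≤ q)))

theorem continuous_lieG {G : E n → Matrix (Fin n) (Fin m) ℝ} {φ : E n → ℝ}
    (hG : ∀ a b, Continuous fun x => G x a b) (hφ : ContDiff ℝ 1 φ) :
    Continuous (lieG G φ) := by
  refine continuous_pi fun b => ?_
  exact (hφ.continuous_fderiv one_ne_zero).clm_apply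
    ((PiLp.continuous_toLp 2 _).comp (continuous_pi fun a => hG a b))

end Smoothness

/-! ### Full row rank of the high-priority tasks on `Ω` -/

namespace TaskSystem

variable {n m k : ℕ} {p : Fin k → ℕ} {S : TaskSystem n m k p} {D : Set (E n)}

theorem Prioritizable.contDiff_lieH (h : S.Prioritizable D) (o : Out p) {s j : ℕ}
    (hs : s + j ≤ S.r o) : ContDiff ℝ s (S.lieH o j) := by
  obtain ⟨q, hq, hf, -, hh⟩ := h.smooth
  exact contDiff_lieF_iterate hf (hh o) j s (hs.trans (hq o))

theorem Prioritizable.continuous_f (h : S.Prioritizable D) : Continuous S.f := by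
  obtain ⟨q, -, hf, -⟩ := h.smooth
  exact hf.continuous

theorem Prioritizable.continuous_G (h : S.Prioritizable D) (a : Fin n) (b : Fin m) :
    Continuous fun x => S.G x a b := by
  obtain ⟨q, -, -, hG, -⟩ := h.smooth
  exact (hG a b).continuous

theorem Prioritizable.continuous_J (h : S.Prioritizable D) : Continuous S.J := by
  refine continuous_pi fun o => continuous_lieG h.continuous_G ?_
  have h1 := (h.relDegree o.1).pos o.2
  exact_mod_cast h.contDiff_lieH o (s := 1) (j := S.r o - 1) (by
    have h2 : 1 ≤ S.r o := h1
    omega)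

theorem Prioritizable.continuous_kappa (h : S.Prioritizable D) : Continuous S.kappa :=
  continuous_pi fun o => (h.contDiff_lieH o (s := 0) (by omega)).continuous

theorem Prioritizable.continuous_xi (h : S.Prioritizable D) : Continuous S.xi :=
  continuous_pi fun s => (h.contDiff_lieH s.1 (s := 0) (by omega)).continuous

theorem P_projection (x : E n) (i : Fin k) : (S.P x i)ᵀ = S.P x i ∧ S.P x i * S.P x i = S.P x i :=
  pinv_mul_self_projection _

theorem rho_eq_rank (x : E n) (i : Fin k) : S.rho x i = (S.Jblk x i * S.Ninit x i.val).rank :=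
  rank_pinv_mul_self _

theorem rho_le (x : E n) (i : Fin k) : S.rho x i ≤ p i := by
  rw [rho_eq_rank]
  exact (Matrix.rank_le_height _)

/-- Since `ρ_i ≤ p_i` for every task, equality of the sums forces equality of each term. -/
theorem rho_eq_of_mem_Omega {c : ℕ} {x : E n} (hx : x ∈ S.Omega D c) {i : Fin k}
    (hi : i.val < c) : S.rho x i = p i :=
  (Finset.sum_eq_sum_iff_of_le fun i _ => S.rho_le x i).1 hx.2 i (by simpa using hi)

theorem vecMul_Jblk_mul_Ninit_injective {c : ℕ} {x : E n} (hx : x ∈ S.Omega D c) {i : Fin k}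
    (hi : i.val < c) : Function.Injective (S.Jblk x i * S.Ninit x i.val).vecMul :=
  vecMul_injective_of_rank (by rw [← rho_eq_rank, rho_eq_of_mem_Omega hx hi, Fintype.card_fin])

theorem Jinit_mul_Ninit (x : E n) (c : ℕ) : S.Jinit x c * S.Ninit x c = 0 := by
  rw [Ninit, Matrix.mul_sub, Matrix.mul_one, ← Matrix.mul_assoc, (pinv_spec _).mul_mul, sub_self]

/-- On `Ω_{1:c}` the rows of the first `c` tasks are linearly independent. -/
theorem eq_zero_of_vecMul_J_eq_zero {c : ℕ} {x : E n} (hx : x ∈ S.Omega D c) :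
    ∀ b ≤ c, ∀ a : Out p → ℝ, (∀ o, b ≤ o.1.val → a o = 0) → a ᵥ* S.J x = 0 → a = 0 := by
  intro b
  induction b with
  | zero => intro _ a ha _; exact funext fun o => ha o (Nat.zero_le _)
  | succ b ih =>
    intro hb a ha ha0
    refine ih (by omega) a (fun o ho => ?_) ha0
    rcases ho.lt_or_eq with ho | ho
    · exact ha o ho
    have hrow : ∀ o' : Out p, o'.1.val < b → (S.J x * S.Ninit x b) o' = 0 := fun o' ho' =>
      congrFun (S.Jinit_mul_Ninit x b) ⟨o', ho'⟩
    -- Multiplication by `N_{1:b}` kills the rows of the first `b` tasks, and the coefficients of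
    -- index above `b` vanish by assumption. Only the block with zero-based index `b` is left, and
    -- `J_b N_{1:b}` has full row rank.
    have h0 : (fun j => a ⟨o.1, j⟩) ᵥ* (S.Jblk x o.1 * S.Ninit x o.1.val) = 0 := by
      have h1 : a ᵥ* (S.J x * S.Ninit x b) = 0 := by
        rw [← Matrix.vecMul_vecMul, ha0, Matrix.zero_vecMul]
      funext e
      have h2 := congrFun h1 e
      rw [Matrix.vecMul, dotProduct, Fintype.sum_sigma, Finset.sum_eq_single o.1 ?_ (by simp)] at h2
      · rw [← ho]; exact h2
      · intro i _ hi
        refine Finset.sum_eq_zero fun j _ => ?_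
        rcases lt_or_ge i.val b with h | h
        · rw [hrow ⟨i, j⟩ h, Pi.zero_apply, mul_zero]
        · have : i.val ≠ b := fun h' => hi (Fin.ext (h'.trans ho))
          rw [ha ⟨i, j⟩ (by show b + 1 ≤ i.val; omega), zero_mul]
    exact congrFun (vecMul_Jblk_mul_Ninit_injective hx (i := o.1) (by omega)
      (h0.trans (Matrix.zero_vecMul _).symm)) o.2

theorem vecMul_Jinit_injective {c : ℕ} {x : E n} (hx : x ∈ S.Omega D c) {b : ℕ} (hb : b ≤ c) :
    Function.Injective (S.Jinit x b).vecMul := by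
  refine (injective_iff_map_eq_zero (Matrix.vecMulLinear (S.Jinit x b))).2 fun a ha => ?_
  have h := eq_zero_of_vecMul_J_eq_zero hx b hb
    (fun o => if h : o.1.val < b then a ⟨o, h⟩ else 0)
    (fun o ho => dif_neg (by omega)) (by
      rw [← ha]
      funext e
      refine (Fintype.sum_of_injective (Subtype.val : {o : Out p // o.1.val < b} → Out p)
        Subtype.val_injective _ _ (fun o ho => ?_) fun o => ?_).symm
      · exact mul_eq_zero_of_left (dif_neg fun h => ho ⟨⟨o, h⟩, rfl⟩) _
      · have h : a o = if h : o.1.1.val < b then a ⟨o.1, h⟩ else 0 := by rw [dif_pos o.2]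
        exact congrArg (· * S.J x o.1 e) h)
  funext o
  have := congrFun h o.1
  rwa [dif_pos o.2] at this

/-- Both pseudoinverses in `P_i`, that of the higher-priority rows and that of `J_i N_{1:i-1}`, act
on matrices of full row rank on `Ω`. -/
theorem Prioritizable.continuousOn_P (h : S.Prioritizable D) {c : ℕ} {s : Set (E n)}
    (hs : s ⊆ S.Omega D c) {i : Fin k} (hi : i.val < c) :
    ContinuousOn (fun x => S.P x i) s := by
  have hJ : ContinuousOn (fun x => S.Jblk x i) s :=
    (h.continuous_J.matrix_submatrix _ _).continuousOn
  have hJi : ContinuousOn (fun x => S.Jinit x i.val) s :=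
    (h.continuous_J.matrix_submatrix _ _).continuousOn
  have hN : ContinuousOn (fun x => S.Ninit x i.val) s :=
    continuousOn_const.sub (continuousOn_matrix_mul
      (continuousOn_pinv hJi fun x hx => vecMul_Jinit_injective (hs hx) hi.le) hJi)
  have hJN := continuousOn_matrix_mul hJ hN
  exact continuousOn_matrix_mul
    (continuousOn_pinv hJN fun x hx => vecMul_Jblk_mul_Ninit_injective (hs hx) hi) hJN

/-- The matrix with the block rows `J_i P_i`. -/
def JP (S : TaskSystem n m k p) (x : E n) : Matrix (Out p) (Fin m) ℝ :=
  Matrix.of fun o => (S.Jblk x o.1 * S.P x o.1) o.2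

theorem JP_apply (x : E n) (o : Out p) (b : Fin m) :
    S.JP x o b = ∑ c, S.J x o c * S.P x o.1 c b := rfl

end TaskSystem

/-! ### Elimination of the factors `L` and `Q` -/

namespace TrackingDesign

variable {n m k d : ℕ} {p : Fin k → ℕ} {S : TaskSystem n m k p} {T : TrackingDesign S d}

theorem LD_mul_Q {x : E n} (h : S.IsOrthogonalization x (T.L x) (T.Q x)) :
    T.LD x * T.Q x = S.JP x := by
  ext ⟨i, a⟩ b
  have h1 : S.JP x ⟨i, a⟩ b = _ := congrFun (congrFun (h.blk i i) a) b
  rw [h1, Matrix.mul_apply, Matrix.mul_apply, Fintype.sum_sigma,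
    Finset.sum_eq_single i ?_ (by simp)]
  · refine Finset.sum_congr rfl fun c _ => ?_
    rw [LD, Matrix.blockDiagonal'_apply_eq]
    rfl
  · intro j _ hj
    exact Finset.sum_eq_zero fun c _ => by
      rw [LD, Matrix.blockDiagonal'_apply_ne _ _ _ hj.symm, zero_mul]

/-- Inserting `Q Qᵀ = 1` between the factors leaves an expression in `J` alone. This matters because
`L` and `Q` are chosen pointwise, with a number of columns that varies with `x`. -/
theorem L_mul_LD_transpose {x : E n} (h : S.IsOrthogonalization x (T.L x) (T.Q x)) :
    T.L x * (T.LD x)ᵀ = S.J x * (S.JP x)ᵀ := by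
  rw [← LD_mul_Q h, h.fac, Matrix.transpose_mul, Matrix.mul_assoc, ← Matrix.mul_assoc (T.Q x),
    h.orthonormal, Matrix.one_mul]

theorem L_mul_LD_transpose_apply {x : E n} (h : S.IsOrthogonalization x (T.L x) (T.Q x))
    {o o' : Out p} (ho : o.1 < o'.1) : (T.L x * (T.LD x)ᵀ) o o' = 0 := by
  rw [Matrix.mul_apply]
  refine Finset.sum_eq_zero fun e _ => ?_
  obtain ⟨i, a⟩ := o
  obtain ⟨i', a'⟩ := o'
  obtain ⟨j, b⟩ := e
  rw [Matrix.transpose_apply, LD]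
  rcases eq_or_ne i' j with rfl | hj
  · rw [h.lower _ _ _ _ ho, zero_mul]
  · rw [Matrix.blockDiagonal'_apply_ne _ _ _ hj, mul_zero]

theorem upi_eq {x : E n} (h : S.IsOrthogonalization x (T.L x) (T.Q x)) (v : Out p → ℝ)
    (w : Fin m → ℝ) :
    T.upi x v w = ((S.JP x)ᵀ * T.Γ x) *ᵥ (v - S.kappa x) + S.N x *ᵥ w := by
  rw [upi, ← LD_mul_Q h, Matrix.transpose_mul]

end TrackingDesign

/-! ### Calculus of the Krasovskii regularization -/

section Krasovskii

theorem krasovskii_map {X Y Z : Type*} [PseudoMetricSpace X] [NormedAddCommGroup Y]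
    [NormedSpace ℝ Y] [NormedAddCommGroup Z] [NormedSpace ℝ Z] (l : Y →L[ℝ] Z) {dom : Set X}
    {g : X → Y} {x : X} {w : Y} (hw : w ∈ krasovskii dom g x) :
    l w ∈ krasovskii dom (fun x => l (g x)) x := by
  rw [krasovskii, mem_iInter] at hw ⊢
  intro δ
  have h := image_closure_subset_closure_image l.continuous (mem_image_of_mem l (hw δ))
  have h2 : l '' convexHull ℝ (g '' (Metric.closedBall x δ ∩ dom))
      = convexHull ℝ (l '' (g '' (Metric.closedBall x δ ∩ dom))) :=
    l.toLinearMap.image_convexHull _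
  rwa [h2, image_image] at h

/-- Regularization is local: for small `δ` only values on `U` enter. -/
theorem krasovskii_subset_of_eqOn {X Y : Type*} [PseudoMetricSpace X] [NormedAddCommGroup Y]
    [NormedSpace ℝ Y] {dom dom' U : Set X} {g g' : X → Y} {x : X} (hU : U ∈ 𝓝 x)
    (hdom : U ⊆ dom) (hg : EqOn g' g U) : krasovskii dom' g' x ⊆ krasovskii dom g x := by
  intro w hw
  rw [krasovskii, mem_iInter] at hw ⊢
  rintro ⟨δ, hδ⟩
  obtain ⟨ε, hε, hεU⟩ := Metric.nhds_basis_closedBall.mem_iff.1 hU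
  refine closure_mono (convexHull_mono ?_) (hw ⟨min δ ε, lt_min hδ hε⟩)
  rintro _ ⟨y, ⟨hy, -⟩, rfl⟩
  have hyU := hεU (Metric.closedBall_subset_closedBall (min_le_right _ _) hy)
  exact ⟨y, ⟨Metric.closedBall_subset_closedBall (min_le_left _ _) hy, hdom hyU⟩, (hg hyU).symm⟩

/-- Closed balls about `g x` are closed and convex, so they contain the hulls for small `δ`. -/
theorem eq_of_mem_krasovskii {X Y : Type*} [PseudoMetricSpace X] [NormedAddCommGroup Y]
    [NormedSpace ℝ Y] {dom : Set X} {g : X → Y} {x : X} (hg : ContinuousWithinAt g dom x)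
    {w : Y} (hw : w ∈ krasovskii dom g x) : w = g x := by
  refine eq_of_forall_dist_le fun ε hε => ?_
  obtain ⟨δ, hδ, h⟩ := (nhdsWithin_hasBasis Metric.nhds_basis_closedBall dom).mem_iff.1
    (hg (Metric.closedBall_mem_nhds (g x) hε))
  rw [krasovskii, mem_iInter] at hw
  refine closure_minimal (convexHull_min ?_ (convex_closedBall (g x) ε))
    Metric.isClosed_closedBall (hw ⟨δ, hδ⟩)
  rintro _ ⟨y, hy, rfl⟩
  exact h hy

end Krasovskii

/-! ### Bounded functions, as `O(1)` along a principal filter -/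

section BoundedOn

variable {Y : Type*} {s : Set Y} {F G : Y → ℝ}

/-- `F` is bounded on `s`. -/
def BoundedOn (s : Set Y) (F : Y → ℝ) : Prop := F =O[𝓟 s] fun _ => (1 : ℝ)

theorem boundedOn_iff : BoundedOn s F ↔ ∃ M, ∀ y ∈ s, |F y| ≤ M := by
  rw [BoundedOn, Asymptotics.isBigO_principal]
  simp

theorem BoundedOn.add (hF : BoundedOn s F) (hG : BoundedOn s G) :
    BoundedOn s fun y => F y + G y := Asymptotics.IsBigO.add hF hG

theorem BoundedOn.sub (hF : BoundedOn s F) (hG : BoundedOn s G) :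
    BoundedOn s fun y => F y - G y := Asymptotics.IsBigO.sub hF hG

theorem BoundedOn.neg (hF : BoundedOn s F) : BoundedOn s fun y => -F y :=
  Asymptotics.IsBigO.neg_left hF

theorem BoundedOn.mul (hF : BoundedOn s F) (hG : BoundedOn s G) :
    BoundedOn s fun y => F y * G y := by
  simpa [BoundedOn] using Asymptotics.IsBigO.mul hF hG

theorem BoundedOn.sum {ι : Type*} {t : Finset ι} {F : ι → Y → ℝ}
    (hF : ∀ i, BoundedOn s (F i)) : BoundedOn s fun y => ∑ i ∈ t, F i y :=
  Asymptotics.IsBigO.fun_sum fun i _ => hF i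

theorem boundedOn_const (c : ℝ) : BoundedOn s fun _ => c :=
  boundedOn_iff.2 ⟨|c|, fun _ _ => le_rfl⟩

theorem boundedOn_of_continuousOn [TopologicalSpace Y] (hs : IsCompact s)
    (hF : ContinuousOn F s) : BoundedOn s F :=
  boundedOn_iff.2 (hs.exists_bound_of_continuousOn hF)

theorem BoundedOn.comp {Y' : Type*} {s' : Set Y'} {φ : Y' → Y} (hF : BoundedOn s F)
    (hφ : MapsTo φ s' s) : BoundedOn s' fun y => F (φ y) := by
  obtain ⟨M, hM⟩ := boundedOn_iff.1 hF
  exact boundedOn_iff.2 ⟨M, fun y hy => hM _ (hφ hy)⟩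

theorem exists_norm_toLp_le {ι : Type*} [Fintype ι] {F : Y → ι → ℝ}
    (hF : ∀ i, BoundedOn s fun y => F y i) :
    ∃ M : ℝ, ∀ y ∈ s, ‖(WithLp.toLp 2 (F y) : EuclideanSpace ℝ ι)‖ ≤ M := by
  choose M hM using fun i => boundedOn_iff.1 (hF i)
  refine ⟨√(∑ i, M i ^ 2), fun y hy => ?_⟩
  rw [EuclideanSpace.norm_eq]
  refine Real.sqrt_le_sqrt (Finset.sum_le_sum fun i _ => ?_)
  exact pow_le_pow_left₀ (norm_nonneg _) (hM i y hy) 2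

end BoundedOn

/-! ### Continuity, measurability and bounds for the closed loop -/

namespace TrackingDesign

variable {n m k d : ℕ} {p : Fin k → ℕ} {S : TaskSystem n m k p} {T : TrackingDesign S d}

namespace Standing

theorem source_subset_D (hT : T.Standing) : T.Φ₀.source ⊆ T.D := fun _ hx => (hT.D₀_subset hx).1

theorem resid_apply (hT : T.Standing) {x : E n} (hx : x ∈ T.D) (o o' : Out p) :
    T.resid x o o' = (1 : Matrix (Out p) (Out p) ℝ) o o'
      - ∑ e, (∑ c, S.J x o c * S.JP x e c) * T.Γ x e o' := by
  rw [resid, L_mul_LD_transpose (hT.orthogonalization x hx)]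
  rfl

theorem continuousOn_JP (hT : T.Standing) {o : Out p} (ho : o.1.val < T.i₀) (b : Fin m) :
    ContinuousOn (fun x => S.JP x o b) T.Φ₀.source := by
  simp only [TaskSystem.JP_apply]
  have hJ := hT.prioritizable.continuous_J
  have hP := hT.prioritizable.continuousOn_P hT.D₀_subset ho
  exact continuousOn_finsetSum _ fun c _ => (hJ.matrix_elem o c).continuousOn.mul
    ((continuous_id.matrix_elem c b).comp_continuousOn hP)

/-- In a high-priority row, `L L_Dᵀ` admits only indices `e` of equal or higher priority. For these,
`Γ e o'` is continuous when `o'` is among the first `i₀` tasks and zero otherwise. The low-priority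
entries of `Γ`, possibly discontinuous, never enter. -/
theorem continuousOn_resid (hT : T.Standing) {o : Out p} (ho : o.1.val < T.i₀) (o' : Out p) :
    ContinuousOn (fun x => T.resid x o o') T.Φ₀.source := by
  refine ContinuousOn.congr ?_ fun x hx => hT.resid_apply (hT.source_subset_D hx) o o'
  refine continuousOn_const.sub (continuousOn_finsetSum _ fun e _ => ?_)
  rcases lt_or_ge o.1 e.1 with he | he
  · refine (continuousOn_const (c := (0 : ℝ))).congr fun x hx => ?_
    have hD := hT.orthogonalization x (hT.source_subset_D hx)
    have h0 : ∑ c, S.J x o c * S.JP x e c = 0 := by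
      have h1 := L_mul_LD_transpose_apply hD he
      rwa [L_mul_LD_transpose hD] at h1
    exact mul_eq_zero_of_left h0 _
  have he0 : e.1.val < T.i₀ := lt_of_le_of_lt he ho
  rcases lt_or_ge o'.1.val T.i₀ with ho' | ho'
  · refine ContinuousOn.mul (continuousOn_finsetSum _ fun c _ => ?_) (hT.Γ_cont e o' he0 ho')
    exact (hT.prioritizable.continuous_J.matrix_elem o c).continuousOn.mul
      (hT.continuousOn_JP he0 c)
  · refine (continuousOn_const (c := (0 : ℝ))).congr fun x hx => ?_
    exact mul_eq_zero_of_right _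
      (hT.Γ_lower x (hT.source_subset_D hx) e.1 o'.1 e.2 o'.2 (he0.trans_le ho'))

theorem continuous_v (hT : T.Standing) (t : ℝ) : Continuous (T.v t) := by
  have h := continuous_pi_iff.1 hT.prioritizable.continuous_xi
  refine continuous_pi fun o => ?_
  refine (Continuous.neg (continuous_finsetSum _ fun s _ => ?_)).add continuous_const
  exact continuous_const.mul ((h _).sub continuous_const)

theorem continuousOn_xiRef (hT : T.Standing) (s : Xi S.r) :
    ContinuousOn (fun t => T.xiRef t s) (Ici 0) :=
  (hT.yref_smooth s.1).continuousOn_iteratedDerivWithin (by exact_mod_cast s.2.2.le)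
    (uniqueDiffOn_Ici 0)

theorem continuousOn_kappaRef (hT : T.Standing) (o : Out p) :
    ContinuousOn (fun t => T.kappaRef t o) (Ici 0) :=
  (hT.yref_smooth o).continuousOn_iteratedDerivWithin le_rfl (uniqueDiffOn_Ici 0)

theorem continuousOn_v_time (hT : T.Standing) (x : E n) (o : Out p) :
    ContinuousOn (fun t => T.v t x o) (Ici 0) := by
  refine (ContinuousOn.neg (continuousOn_finsetSum _ fun s _ => ?_)).add
    (hT.continuousOn_kappaRef o)
  exact continuousOn_const.mul (continuousOn_const.sub (hT.continuousOn_xiRef _))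

theorem continuousOn_xiRhs (hT : T.Standing) (t : ℝ) {s : Xi S.r} (hs : s.1.1.val < T.i₀) :
    ContinuousOn (fun z => T.xiRhs t z s) T.Φ₀.target := by
  have hx := T.Φ₀.continuousOn_symm
  have hxi := continuous_pi_iff.1 hT.prioritizable.continuous_xi
  have hka := continuous_pi_iff.1 hT.prioritizable.continuous_kappa
  have hv := continuous_pi_iff.1 (hT.continuous_v t)
  have key : ContinuousOn (fun x => (S.A *ᵥ S.xi x) s
      + (S.B *ᵥ (T.v t x - T.resid x *ᵥ (T.v t x - S.kappa x))) s) T.Φ₀.source := by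
    refine ContinuousOn.add (continuousOn_finsetSum _ fun s' _ =>
      continuousOn_const.mul (hxi s').continuousOn) (continuousOn_finsetSum _ fun o _ => ?_)
    -- Row `s` of `B` sees only the output `s.1`, so only a high-priority row of `E` contributes.
    by_cases ho : s.1 = o
    · subst ho
      exact continuousOn_const.mul ((hv _).continuousOn.sub (continuousOn_finsetSum _ fun o' _ =>
        (hT.continuousOn_resid hs o').mul ((hv o').sub (hka o')).continuousOn))
    · refine (continuousOn_const (c := (0 : ℝ))).congr fun x _ => ?_
      exact mul_eq_zero_of_left (if_neg fun h => ho h.1) _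
  exact key.comp hx T.Φ₀.mapsTo_symm

theorem continuousOn_xiRhs_time (hT : T.Standing) (z : ZSpace S.r T.i₀ d) (s : Xi S.r) :
    ContinuousOn (fun t => T.xiRhs t z s) (Ici 0) := by
  have hv := hT.continuousOn_v_time (T.Φ₀.symm z)
  refine ContinuousOn.add continuousOn_const (continuousOn_finsetSum _ fun o _ =>
    continuousOn_const.mul ((hv o).sub (continuousOn_finsetSum _ fun o' _ =>
      continuousOn_const.mul ((hv o').sub continuousOn_const))))

theorem aemeasurable_etaRhs (hT : T.Standing) {z : ZSpace S.r T.i₀ d} (hz : z ∈ T.C₀)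
    (a : Fin d) : AEMeasurable (fun t => T.etaRhs t z a) (volume.restrict (Ici 0)) := by
  have hv : ∀ o, AEMeasurable (fun t => T.v t (T.Φ₀.symm z) o) (volume.restrict (Ici 0)) :=
    fun o => (hT.continuousOn_v_time _ o).aemeasurable measurableSet_Ici
  have hu : ∀ b, AEMeasurable (fun t => T.uf t (T.Φ₀.symm z) b) (volume.restrict (Ici 0)) :=
    fun b => (measurable_pi_apply b).comp_aemeasurable (hT.uf_meas _ (mem_image_of_mem _ hz))
  have hN : ∀ b, AEMeasurable (fun t => ∑ e, S.N (T.Φ₀.symm z) b e * T.uf t (T.Φ₀.symm z) e)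
      (volume.restrict (Ici 0)) := fun b =>
    Finset.aemeasurable_fun_sum _ fun e _ => (hu e).const_mul _
  have hupi : ∀ b, AEMeasurable
      (fun t => T.upi (T.Φ₀.symm z) (T.v t (T.Φ₀.symm z)) (T.uf t (T.Φ₀.symm z)) b)
      (volume.restrict (Ici 0)) := fun b =>
    AEMeasurable.add
      (Finset.aemeasurable_fun_sum _ fun o _ => AEMeasurable.const_mul ((hv o).sub_const _) _)
      (hN b)
  have hG : AEMeasurable (fun t => ∑ b, T.G₀ (T.Φ₀.symm z) a b *
      T.upi (T.Φ₀.symm z) (T.v t (T.Φ₀.symm z)) (T.uf t (T.Φ₀.symm z)) b)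
      (volume.restrict (Ici 0)) :=
    Finset.aemeasurable_fun_sum _ fun b _ => (hupi b).const_mul _
  exact hG.const_add (T.f₀ (T.Φ₀.symm z) a)

theorem isCompact_symm_image (hT : T.Standing) : IsCompact (T.Φ₀.symm '' T.C₀) :=
  hT.C₀_compact.image_of_continuousOn (T.Φ₀.continuousOn_symm.mono hT.C₀_subset)

theorem symm_image_subset (hT : T.Standing) : T.Φ₀.symm '' T.C₀ ⊆ T.Φ₀.source := by
  rintro _ ⟨z, hz, rfl⟩
  exact T.Φ₀.map_target (hT.C₀_subset hz)

theorem boundedOn_J (hT : T.Standing) (o : Out p) (b : Fin m) :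
    BoundedOn (T.Φ₀.symm '' T.C₀) fun x => S.J x o b :=
  boundedOn_of_continuousOn hT.isCompact_symm_image
    (hT.prioritizable.continuous_J.matrix_elem o b).continuousOn

theorem boundedOn_JP (hT : T.Standing) (o : Out p) (b : Fin m) :
    BoundedOn (T.Φ₀.symm '' T.C₀) fun x => S.JP x o b := by
  simp only [TaskSystem.JP_apply]
  refine BoundedOn.sum fun c => (hT.boundedOn_J o c).mul (boundedOn_iff.2 ⟨1, fun x _ => ?_⟩)
  exact abs_apply_le_one_of_projection (S.P_projection x o.1).1 (S.P_projection x o.1).2 c b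

theorem boundedOn_N (b c : Fin m) : BoundedOn (T.Φ₀.symm '' T.C₀) fun x => S.N x b c :=
  boundedOn_iff.2 ⟨1, fun x _ => abs_apply_le_one_of_projection
    (one_sub_pinv_mul_self_projection (S.J x)).1 (one_sub_pinv_mul_self_projection (S.J x)).2 b c⟩

theorem boundedOn_Γ (hT : T.Standing) (o o' : Out p) :
    BoundedOn (T.Φ₀.symm '' T.C₀) fun x => T.Γ x o o' := by
  obtain ⟨M, hM⟩ := hT.Γ_bdd _ hT.symm_image_subset hT.isCompact_symm_image
  exact boundedOn_iff.2 ⟨M, fun x hx => hM x hx o o'⟩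

theorem boundedOn_resid (hT : T.Standing) (o o' : Out p) :
    BoundedOn (T.Φ₀.symm '' T.C₀) fun x => T.resid x o o' := by
  have h : BoundedOn (T.Φ₀.symm '' T.C₀) fun x => (1 : Matrix (Out p) (Out p) ℝ) o o'
      - ∑ e, (∑ c, S.J x o c * S.JP x e c) * T.Γ x e o' :=
    (boundedOn_const _).sub (BoundedOn.sum fun e =>
      (BoundedOn.sum fun c => (hT.boundedOn_J o c).mul (hT.boundedOn_JP e c)).mul
        (hT.boundedOn_Γ e o'))
  obtain ⟨M, hM⟩ := boundedOn_iff.1 h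
  refine boundedOn_iff.2 ⟨M, fun x hx => ?_⟩
  rw [hT.resid_apply (hT.source_subset_D (hT.symm_image_subset hx))]
  exact hM x hx

theorem boundedOn_kappa (hT : T.Standing) (o : Out p) :
    BoundedOn (T.Φ₀.symm '' T.C₀) fun x => S.kappa x o :=
  boundedOn_of_continuousOn hT.isCompact_symm_image
    (continuous_pi_iff.1 hT.prioritizable.continuous_kappa o).continuousOn

theorem boundedOn_xi (hT : T.Standing) (s : Xi S.r) :
    BoundedOn (T.Φ₀.symm '' T.C₀) fun x => S.xi x s :=
  boundedOn_of_continuousOn hT.isCompact_symm_image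
    (continuous_pi_iff.1 hT.prioritizable.continuous_xi s).continuousOn

theorem continuousOn_fderiv_phiEta (hT : T.Standing) (a : Fin d) :
    ContinuousOn (fderiv ℝ (T.phiEta a)) T.Φ₀.source := by
  have h : ContDiffOn ℝ 1 (T.phiEta a) T.Φ₀.source := by
    have := (contDiffOn_euclidean.1 hT.Φ₀_smooth) (Sum.inl a)
    exact this
  exact h.continuousOn_fderiv_of_isOpen T.Φ₀.open_source le_rfl

theorem boundedOn_f₀ (hT : T.Standing) (a : Fin d) :
    BoundedOn (T.Φ₀.symm '' T.C₀) fun x => T.f₀ x a :=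
  boundedOn_of_continuousOn hT.isCompact_symm_image
    (((hT.continuousOn_fderiv_phiEta a).clm_apply
      hT.prioritizable.continuous_f.continuousOn).mono hT.symm_image_subset)

theorem boundedOn_G₀ (hT : T.Standing) (a : Fin d) (b : Fin m) :
    BoundedOn (T.Φ₀.symm '' T.C₀) fun x => T.G₀ x a b :=
  boundedOn_of_continuousOn hT.isCompact_symm_image
    (((hT.continuousOn_fderiv_phiEta a).clm_apply ((PiLp.continuous_toLp 2 _).comp
      (continuous_pi fun e => hT.prioritizable.continuous_G e b)).continuousOn).mono
      hT.symm_image_subset)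

theorem boundedOn_v (hT : T.Standing) (o : Out p) :
    BoundedOn (Ici 0 ×ˢ (T.Φ₀.symm '' T.C₀)) fun q : ℝ × E n => T.v q.1 q.2 o := by
  obtain ⟨M, hM⟩ := hT.xiRef_bdd
  obtain ⟨M', hM'⟩ := hT.kappaRef_bdd
  refine BoundedOn.add (BoundedOn.neg (BoundedOn.sum fun s => (boundedOn_const _).mul
    (((hT.boundedOn_xi _).comp fun q hq => hq.2).sub ?_))) ?_
  · exact boundedOn_iff.2 ⟨M, fun q hq => hM q.1 hq.1 _⟩
  · exact boundedOn_iff.2 ⟨M', fun q hq => hM' q.1 hq.1 o⟩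

theorem boundedOn_v_sub_kappa (hT : T.Standing) (o : Out p) :
    BoundedOn (Ici 0 ×ˢ (T.Φ₀.symm '' T.C₀)) fun q : ℝ × E n => (T.v q.1 q.2 - S.kappa q.2) o :=
  (hT.boundedOn_v o).sub ((hT.boundedOn_kappa o).comp fun _ hq => hq.2)

theorem boundedOn_uf (hT : T.Standing) (b : Fin m) :
    BoundedOn (Ici 0 ×ˢ (T.Φ₀.symm '' T.C₀)) fun q : ℝ × E n => T.uf q.1 q.2 b := by
  obtain ⟨U, -, hU, hmem⟩ := hT.uf_mem
  exact (boundedOn_of_continuousOn hU (continuous_apply b).continuousOn).comp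
    (φ := fun q : ℝ × E n => T.uf q.1 q.2) fun q hq => hmem q.1 hq.1 q.2 hq.2

theorem boundedOn_upi (hT : T.Standing) (b : Fin m) :
    BoundedOn (Ici 0 ×ˢ (T.Φ₀.symm '' T.C₀)) fun q : ℝ × E n =>
      T.upi q.2 (T.v q.1 q.2) (T.uf q.1 q.2) b := by
  have hJΓ : ∀ o, BoundedOn (T.Φ₀.symm '' T.C₀) fun x => ∑ e, S.JP x e b * T.Γ x e o :=
    fun o => BoundedOn.sum fun e => (hT.boundedOn_JP e b).mul (hT.boundedOn_Γ e o)
  have h : BoundedOn (Ici 0 ×ˢ (T.Φ₀.symm '' T.C₀)) fun q : ℝ × E n =>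
      (∑ o, (∑ e, S.JP q.2 e b * T.Γ q.2 e o) * (T.v q.1 q.2 - S.kappa q.2) o)
        + ∑ c, S.N q.2 b c * T.uf q.1 q.2 c :=
    BoundedOn.add (BoundedOn.sum fun o => ((hJΓ o).comp fun q hq => hq.2).mul
        (hT.boundedOn_v_sub_kappa o))
      (BoundedOn.sum fun c => ((boundedOn_N b c).comp fun q hq => hq.2).mul (hT.boundedOn_uf c))
  obtain ⟨M, hM⟩ := boundedOn_iff.1 h
  refine boundedOn_iff.2 ⟨M, fun q hq => ?_⟩
  rw [upi_eq (hT.orthogonalization _ (hT.source_subset_D (hT.symm_image_subset hq.2)))]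
  exact hM q hq

theorem boundedOn_etaRhs (hT : T.Standing) (a : Fin d) :
    BoundedOn (Ici 0 ×ˢ T.C₀) fun q : ℝ × ZSpace S.r T.i₀ d => T.etaRhs q.1 q.2 a := by
  have h : BoundedOn (Ici 0 ×ˢ (T.Φ₀.symm '' T.C₀)) fun q : ℝ × E n =>
      T.f₀ q.2 a + ∑ b, T.G₀ q.2 a b * T.upi q.2 (T.v q.1 q.2) (T.uf q.1 q.2) b :=
    ((hT.boundedOn_f₀ a).comp fun q hq => hq.2).add
      (BoundedOn.sum fun b => ((hT.boundedOn_G₀ a b).comp fun q hq => hq.2).mul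
        (hT.boundedOn_upi b))
  exact h.comp (φ := fun q : ℝ × ZSpace S.r T.i₀ d => (q.1, T.Φ₀.symm q.2))
    fun q hq => ⟨hq.1, mem_image_of_mem _ hq.2⟩

theorem boundedOn_xiRhs (hT : T.Standing) (s : Xi S.r) :
    BoundedOn (Ici 0 ×ˢ T.C₀) fun q : ℝ × ZSpace S.r T.i₀ d => T.xiRhs q.1 q.2 s := by
  have h : BoundedOn (Ici 0 ×ˢ (T.Φ₀.symm '' T.C₀)) fun q : ℝ × E n =>
      (∑ s', S.A s s' * S.xi q.2 s') + ∑ o, S.B s o * (T.v q.1 q.2 o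
        - ∑ o', T.resid q.2 o o' * (T.v q.1 q.2 - S.kappa q.2) o') :=
    BoundedOn.add
      (BoundedOn.sum fun s' => (boundedOn_const _).mul ((hT.boundedOn_xi s').comp fun q hq => hq.2))
      (BoundedOn.sum fun o => (boundedOn_const _).mul ((hT.boundedOn_v o).sub
        (BoundedOn.sum fun o' => ((hT.boundedOn_resid o o').comp fun q hq => hq.2).mul
          (hT.boundedOn_v_sub_kappa o'))))
  exact h.comp (φ := fun q : ℝ × ZSpace S.r T.i₀ d => (q.1, T.Φ₀.symm q.2))
    fun q hq => ⟨hq.1, mem_image_of_mem _ hq.2⟩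

end Standing

/-! ### Truncation of the field to the region -/

variable (T) in
/-- The right-hand side of the closed loop, before regularization. -/
def closedLoop (t : ℝ) (z : ZSpace S.r T.i₀ d) : ZSpace S.r T.i₀ d :=
  WithLp.toLp 2 (Sum.elim (T.etaRhs t z) fun s => T.xiRhs t z s.1)

theorem Standing.krasovskii_subset_inclusion (hT : T.Standing) (t : ℝ)
    {z : ZSpace S.r T.i₀ d} (hz : z ∈ T.Φ₀.target) :
    krasovskii T.Φ₀.target (T.closedLoop t) z ⊆ T.inclusion t z := by
  intro w hw
  refine ⟨?_, fun s => ?_⟩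
  · have h := krasovskii_map (ContinuousLinearMap.pi fun a : Fin d =>
      (EuclideanSpace.proj (Sum.inl a) : ZSpace S.r T.i₀ d →L[ℝ] ℝ)) hw
    have hg : (fun z' => (ContinuousLinearMap.pi fun a : Fin d =>
        (EuclideanSpace.proj (Sum.inl a) : ZSpace S.r T.i₀ d →L[ℝ] ℝ)) (T.closedLoop t z'))
        = T.etaRhs t := by
      funext z' a
      rfl
    rw [hg] at h
    exact h
  · have h := krasovskii_map (EuclideanSpace.proj (Sum.inr s) : ZSpace S.r T.i₀ d →L[ℝ] ℝ) hw
    have hg : (fun z' => (EuclideanSpace.proj (Sum.inr s) : ZSpace S.r T.i₀ d →L[ℝ] ℝ)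
        (T.closedLoop t z')) = fun z' => T.xiRhs t z' s.1 := by
      funext z'
      rfl
    rw [hg] at h
    exact eq_of_mem_krasovskii (hT.continuousOn_xiRhs t s.2 z hz) h

/-- A curve that follows the inclusion as long as it stays in the interior of the region. -/
theorem Standing.exists_curve (hT : T.Standing) (z₀ : ZSpace S.r T.i₀ d) :
    ∃ (z : ℝ → ZSpace S.r T.i₀ d) (K : NNReal), z 0 = z₀ ∧ LipschitzWith K z ∧
      ∀ᵐ t, 0 ≤ t → z t ∈ interior T.C₀ → ∃ w ∈ T.inclusion t (z t), HasDerivAt z w t := by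
  classical
  obtain ⟨M, hM⟩ := exists_norm_toLp_le (s := Ici 0 ×ˢ T.C₀)
    (F := fun q : ℝ × ZSpace S.r T.i₀ d =>
      Sum.elim (T.etaRhs q.1 q.2) fun s : Xi0 S.r T.i₀ => T.xiRhs q.1 q.2 s.1)
    (by rintro (a | s); exacts [hT.boundedOn_etaRhs a, hT.boundedOn_xiRhs s.1])
  -- Zero outside `C₀` and at negative times: all bounds and measurability are available only on
  -- `[0, ∞) × C₀`.
  obtain ⟨g, hg⟩ : ∃ g : ℝ → ZSpace S.r T.i₀ d → ZSpace S.r T.i₀ d,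
      g = fun t z => if 0 ≤ t ∧ z ∈ T.C₀ then T.closedLoop t z else 0 := ⟨_, rfl⟩
  have hgM : ∀ t z, ‖g t z‖ ≤ max M 0 := by
    intro t z
    rw [hg]
    dsimp only
    split_ifs with h
    · exact (hM (t, z) ⟨h.1, h.2⟩).trans (le_max_left _ _)
    · simp
  have hgm : ∀ z, AEStronglyMeasurable (fun t => g t z) volume := by
    intro z
    by_cases hz : z ∈ T.C₀
    · have h : (fun t => g t z) = (Ici (0 : ℝ)).indicator fun t => T.closedLoop t z := by
        funext t
        simp [hg, hz, indicator]
      rw [h, aestronglyMeasurable_indicator_iff measurableSet_Ici]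
      refine (PiLp.continuous_toLp 2 _).comp_aestronglyMeasurable
        (aemeasurable_pi_lambda _ ?_).aestronglyMeasurable
      rintro (a | s)
      · exact hT.aemeasurable_etaRhs hz a
      · exact (hT.continuousOn_xiRhs_time z s.1).aemeasurable measurableSet_Ici
    · have h : (fun t => g t z) = fun _ => 0 := by
        funext t
        simp [hg, hz]
      rw [h]
      exact aestronglyMeasurable_const
  obtain ⟨z, hz0, hzl, hz⟩ := exists_krasovskii_solution hgM hgm z₀
  refine ⟨z, _, hz0, hzl, ?_⟩
  filter_upwards [hz] with t ht ht0 hint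
  obtain ⟨w, hw, hd⟩ := ht ht0
  refine ⟨w, hT.krasovskii_subset_inclusion t (hT.C₀_subset (interior_subset hint)) ?_, hd⟩
  -- At an interior point, `C₀` is a neighbourhood on which the truncated and the original field
  -- agree.
  refine krasovskii_subset_of_eqOn (mem_interior_iff_mem_nhds.1 hint) hT.C₀_subset
    (fun y hy => ?_) hw
  rw [hg]
  exact if_pos ⟨ht0, hy⟩

end TrackingDesign

end PriorityControl

end

/-! ### First exit from the interior -/

theorem lemma7 {n m k d : ℕ} {p : Fin k → ℕ} (S : PriorityControl.TaskSystem n m k p)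
    (T : PriorityControl.TrackingDesign S d) (hT : T.Standing)
    (z₀ : PriorityControl.ZSpace S.r T.i₀ d) (hz₀ : z₀ ∈ interior T.C₀) :
    ∃ (τ : EReal) (z : ℝ → PriorityControl.ZSpace S.r T.i₀ d),
      0 < τ ∧ z 0 = z₀ ∧
      (∀ t : ℝ, 0 ≤ t → (t : EReal) < τ → z t ∈ interior T.C₀) ∧
      T.IsKrasovskiiSolution τ z ∧
      (τ = ⊤ ∨ ∃ b : ℝ, τ = (b : EReal) ∧ AbsolutelyContinuousOnInterval z 0 b ∧
        z b ∈ frontier T.C₀) := by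
  obtain ⟨z, K, hz0, hzl, hz⟩ := hT.exists_curve z₀
  -- The curve is Lipschitz on all of `ℝ`, so the extension to a finite exit time is automatic.
  have hac : ∀ b, AbsolutelyContinuousOnInterval z 0 b := fun b =>
    hzl.lipschitzOnWith.absolutelyContinuousOnInterval
  by_cases hstay : ∀ t, 0 ≤ t → z t ∈ interior T.C₀
  · refine ⟨⊤, z, EReal.zero_lt_top, hz0, fun t ht _ => hstay t ht, ⟨fun b _ _ => hac b, ?_⟩,
      Or.inl rfl⟩
    filter_upwards [hz] with t ht ht0 _ using ht ht0 (hstay t ht0)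
  push Not at hstay
  obtain ⟨Z, hZ⟩ : ∃ Z : Set ℝ, Z = {t | 0 ≤ t ∧ z t ∉ interior T.C₀} := ⟨_, rfl⟩
  have hZc : IsClosed Z := by
    rw [hZ]
    exact isClosed_Ici.inter (isOpen_interior.isClosed_compl.preimage hzl.continuous)
  have hZb : BddBelow Z := ⟨0, fun t ht => by rw [hZ] at ht; exact ht.1⟩
  have hZn : Z.Nonempty := by
    obtain ⟨t, ht⟩ := hstay
    exact ⟨t, by rw [hZ]; exact ht⟩
  obtain ⟨b, hb⟩ : ∃ b, b = sInf Z := ⟨_, rfl⟩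
  have hbZ : 0 ≤ b ∧ z b ∉ interior T.C₀ := by
    have := hZc.csInf_mem hZn hZb
    rw [← hb] at this
    rwa [hZ] at this
  have hlt : ∀ t, 0 ≤ t → t < b → z t ∈ interior T.C₀ := fun t ht htb => by
    by_contra h
    exact absurd (csInf_le hZb (show t ∈ Z by rw [hZ]; exact ⟨ht, h⟩)) (by rw [← hb]; exact htb.not_ge)
  -- The exit time is positive because the initial point is interior.
  have hb0 : 0 < b := lt_of_le_of_ne hbZ.1 fun h => hbZ.2 (by rw [← h, hz0]; exact hz₀)
  refine ⟨b, z, by exact_mod_cast hb0, hz0, fun t ht htb => hlt t ht (by exact_mod_cast htb),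
    ⟨fun b _ _ => hac b, ?_⟩, Or.inr ⟨b, rfl, hac b, ?_, hbZ.2⟩⟩
  · filter_upwards [hz] with t ht ht0 htb using ht ht0 (hlt t ht0 (by exact_mod_cast htb))
  -- The exit point is a limit of interior points of `C₀` without being one, hence a boundary point.
  · have hcl : b ∈ closure (Ico 0 b) := by
      rw [closure_Ico hb0.ne]
      exact right_mem_Icc.2 hb0.le
    refine closure_mono (?_ : z '' Ico 0 b ⊆ T.C₀)
      (image_closure_subset_closure_image hzl.continuous (mem_image_of_mem z hcl))
    rintro _ ⟨t, ht, rfl⟩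
    exact interior_subset (hlt t ht.1 ht.2)
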